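/- Let $k$ be a field and let $n>1$ and $t\ge 2$ be integers. Let $\widetilde{\mathbb A}_{n-1}$ be the quiver with $n$ vertices and exactly one arrow starting in each vertex, forming an oriented cycle; let $J$ be the two-sided ideal of the path algebra $k\widetilde{\mathbb A}_{n-1}$ generated by the arrows, and let $\Lambda_{n,t}=k\widetilde{\mathbb A}_{n-1}/J^t$ be the corresponding selfinjective Nakayama algebra. Write $t=qn+r$ with $q\ge 0$ and $0\le r<n$. Let $l_1$ be the order of the subgroup $\langle r+n\mathbb Z\rangle$ of $\mathbb Z_n=\mathbb Z/n\mathbb Z$, and let $l_2\ge 0$ be the smallest integer with $l_2r+1\equiv 0 \pmod n$, if such an integer exists. Let $S$ be a simple $\Lambda_{n,t}$-module. Then, as graded $k$-algebras (with the Yoneda product on $\operatorname{Ext}^*_{\Lambda_{n,t}}(S,S)=\bigoplus_{i\ge 0}\operatorname{Ext}^i_{\Lambda_{n,t}}(S,S)$), $$\operatorname{Ext}^*_{\Lambda_{n,t}}(S,S)\simeq\begin{cases} k[x], & \text{if } l_2 \text{ does not exist},\\ k[x,y]/\langle y^2\rangle, & \text{if } l_2 \text{ exists and } t\ge 3,\\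 k[y], & \text{if } l_2\text{ exists and } t=2,\end{cases}$$ where $x$ has degree $2l_1$ and $y$ has degree $2l_2+1$. -/

import Mathlib

open CategoryTheory

universe w v u

noncomputable section

/-! ### Path algebras of quivers -/

/-- The paths of a quiver, with arbitrary source `p.1` and target `p.2.1`. -/
abbrev QuiverPath (V : Type u) [Quiver.{v} V] : Type (max u v) :=
  Σ a b : V, Quiver.Path a b

/-- The underlying vector space of the path algebra `kV`: it has the set of all paths as basis. -/
def PathAlgebra (k : Type w) [Field k] (V : Type u) [Quiver.{v} V] : Type (max u v w) :=
  QuiverPath V →₀ k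

namespace PathAlgebra

variable (k : Type w) [Field k] {V : Type u} [Quiver.{v} V]

instance : AddCommGroup (PathAlgebra k V) := inferInstanceAs (AddCommGroup (QuiverPath V →₀ k))

instance : Module k (PathAlgebra k V) := inferInstanceAs (Module k (QuiverPath V →₀ k))

/-- The basis element given by a path. -/
def ofPath {a b : V} (p : Quiver.Path a b) : PathAlgebra k V :=
  (Finsupp.single ⟨a, b, p⟩ 1 : QuiverPath V →₀ k)

/-- The trivial path at the vertex `a`. -/
def vertex (a : V) : PathAlgebra k V := ofPath k (Quiver.Path.nil : Quiver.Path a a)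

/-- The path of length one given by an arrow. -/
def arrow {a b : V} (e : a ⟶ b) : PathAlgebra k V := ofPath k e.toPath

open Classical in
/-- The product `p * q` of two paths: the concatenation "first `q`, then `p`" if `q` ends where
`p` starts, and zero otherwise. -/
def mulPath (p q : QuiverPath V) : PathAlgebra k V :=
  if h : q.2.1 = p.1 then ofPath k (q.2.2.comp (p.2.2.cast h.symm rfl)) else 0

variable {k} in
/-- The linear map out of the path algebra with prescribed values on the paths. -/
def liftPaths {M : Type*} [AddCommGroup M] [Module k M] (f : QuiverPath V → M) :
    PathAlgebra k V →ₗ[k] M :=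
  Finsupp.lift M k (QuiverPath V) f

/-- The bilinear extension of the product of paths. -/
def mulHom : PathAlgebra k V →ₗ[k] PathAlgebra k V →ₗ[k] PathAlgebra k V :=
  liftPaths fun p => liftPaths fun q => mulPath k p q

instance : Mul (PathAlgebra k V) := ⟨fun x y => mulHom k x y⟩

/-- The identity element is the sum of all trivial paths. -/
instance [Fintype V] : One (PathAlgebra k V) := ⟨∑ a : V, vertex k a⟩

variable {k}

theorem mul_def (x y : PathAlgebra k V) : x * y = mulHom k x y := rfl

theorem liftPaths_ofPath {M : Type*} [AddCommGroup M] [Module k M] (f : QuiverPath V → M)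
    {a b : V} (p : Quiver.Path a b) : liftPaths f (ofPath k p) = f ⟨a, b, p⟩ :=
  (Finsupp.sum_single_index (a := (⟨a, b, p⟩ : QuiverPath V)) (b := (1 : k))
    (h := fun x r => r • f x) (zero_smul k _)).trans (one_smul k _)

theorem mulHom_ofPath {a b c d : V} (p : Quiver.Path a b) (q : Quiver.Path c d) :
    mulHom k (ofPath k p) (ofPath k q) = mulPath k ⟨a, b, p⟩ ⟨c, d, q⟩ := by
  rw [mulHom, liftPaths_ofPath, liftPaths_ofPath]

theorem ofPath_mul_ofPath {a b c : V} (p : Quiver.Path b c) (q : Quiver.Path a b) :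
    ofPath k p * ofPath k q = ofPath k (q.comp p) := by
  rw [mul_def, mulHom_ofPath, mulPath, dif_pos rfl]
  rfl

theorem ofPath_mul_ofPath_of_ne {a b c d : V} (p : Quiver.Path c d) (q : Quiver.Path a b)
    (h : b ≠ c) : ofPath k p * ofPath k q = 0 := by
  rw [mul_def, mulHom_ofPath, mulPath, dif_neg h]

/-- A linear map out of the path algebra is determined by its values on paths. -/
theorem hom_ext {M : Type*} [AddCommGroup M] [Module k M] {f g : PathAlgebra k V →ₗ[k] M}
    (h : ∀ (a b : V) (p : Quiver.Path a b), f (ofPath k p) = g (ofPath k p)) : f = g := by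
  refine Finsupp.lhom_ext' (R := k) (α := QuiverPath V) (M := k) fun ⟨a, b, p⟩ => ?_
  exact LinearMap.ext_ring (h a b p)

theorem mul_assoc_paths (x y z : PathAlgebra k V) : x * y * z = x * (y * z) := by
  have key : (mulHom k).compr₂ (mulHom k)
      = ((LinearMap.llcomp k (PathAlgebra k V) (PathAlgebra k V) (PathAlgebra k V)).flip.comp
          (mulHom k)).flip.comp (mulHom k) := by
    refine hom_ext fun a b p => hom_ext fun c d q => hom_ext fun e f r => ?_
    change ofPath k p * ofPath k q * ofPath k r = ofPath k p * (ofPath k q * ofPath k r)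
    by_cases h₁ : d = a
    · subst h₁
      by_cases h₂ : f = c
      · subst h₂
        simp only [ofPath_mul_ofPath, Quiver.Path.comp_assoc]
      · rw [ofPath_mul_ofPath, ofPath_mul_ofPath_of_ne _ _ h₂, ofPath_mul_ofPath_of_ne _ _ h₂,
          mul_def, map_zero]
    · rw [ofPath_mul_ofPath_of_ne _ _ h₁, mul_def 0, map_zero, LinearMap.zero_apply]
      by_cases h₂ : f = c
      · subst h₂
        rw [ofPath_mul_ofPath, ofPath_mul_ofPath_of_ne _ _ h₁]
      · rw [ofPath_mul_ofPath_of_ne _ _ h₂, mul_def, map_zero]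
  exact LinearMap.congr_fun (LinearMap.congr_fun (LinearMap.congr_fun key x) y) z

theorem one_mul_paths [Fintype V] (x : PathAlgebra k V) : 1 * x = x := by
  have key : mulHom k (1 : PathAlgebra k V) = LinearMap.id := by
    refine hom_ext fun a b p => ?_
    change mulHom k (∑ c : V, vertex k c) (ofPath k p) = ofPath k p
    rw [map_sum, LinearMap.sum_apply, Finset.sum_eq_single b]
    · exact ofPath_mul_ofPath _ _
    · exact fun c _ hc => ofPath_mul_ofPath_of_ne _ _ hc.symm
    · simp
  exact LinearMap.congr_fun key x

theorem mul_one_paths [Fintype V] (x : PathAlgebra k V) : x * 1 = x := by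
  have key : (mulHom k).flip (1 : PathAlgebra k V) = LinearMap.id := by
    refine hom_ext fun a b p => ?_
    change mulHom k (ofPath k p) (∑ c : V, vertex k c) = ofPath k p
    rw [map_sum, Finset.sum_eq_single a]
    · exact (ofPath_mul_ofPath _ _).trans (by rw [Quiver.Path.nil_comp])
    · exact fun c _ hc => ofPath_mul_ofPath_of_ne _ _ hc
    · simp
  exact LinearMap.congr_fun key x

instance [Fintype V] : Ring (PathAlgebra k V) where
  __ := (inferInstance : AddCommGroup (PathAlgebra k V))
  left_distrib x y z := map_add (mulHom k x) y z
  right_distrib x y z := LinearMap.congr_fun (map_add (mulHom k) x y) z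
  zero_mul x := LinearMap.congr_fun (map_zero (mulHom k)) x
  mul_zero x := map_zero (mulHom k x)
  mul_assoc := mul_assoc_paths
  one_mul := one_mul_paths
  mul_one := mul_one_paths

instance [Fintype V] : Algebra k (PathAlgebra k V) :=
  Algebra.ofModule (fun r x y => LinearMap.congr_fun (map_smul (mulHom k) r x) y)
    (fun r x y => map_smul (mulHom k x) r y)

variable (k V)

/-- The two-sided ideal of the path algebra generated by the arrows. -/
def arrowIdeal [Fintype V] : Ideal (PathAlgebra k V) :=
  (TwoSidedIdeal.span {x | ∃ (a b : V) (e : a ⟶ b), x = arrow k e}).asIdeal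

instance [Fintype V] : (arrowIdeal k V).IsTwoSided :=
  inferInstanceAs (TwoSidedIdeal.asIdeal _).IsTwoSided

end PathAlgebra

/-! ### Selfinjective Nakayama algebras -/

/-- The vertices of the cyclic quiver `Ã_m`, which has `m + 1` vertices. -/
def ATilde (m : ℕ) : Type := ZMod (m + 1)

namespace ATilde

instance (m : ℕ) : Fintype (ATilde m) := inferInstanceAs (Fintype (ZMod (m + 1)))

/-- The successor `i + 1` of the vertex `i` on the oriented cycle. -/
def next {m : ℕ} (i : ATilde m) : ATilde m := (show ZMod (m + 1) from i) + 1

/-- There is exactly one arrow starting in each vertex `i`, and it ends in `i + 1`. -/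
instance (m : ℕ) : Quiver.{0} (ATilde m) where
  Hom i j := PLift (j = next i)

end ATilde

/-- The algebra `Λ_{n,t} = k Ã_{n-1} / J^t`, where `J` is generated by the arrows (`n ≥ 1`). -/
abbrev NakayamaAlgebra (k : Type u) [Field k] (n t : ℕ) : Type u :=
  PathAlgebra k (ATilde (n - 1)) ⧸ PathAlgebra.arrowIdeal k (ATilde (n - 1)) ^ t

/-! ### The Ext-algebra of an object of a linear abelian category -/

namespace ExtAlg

open CategoryTheory.Abelian

variable {C : Type u} [Category.{v} C] [Abelian C] [HasExt.{w} C]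

theorem mk_comp_eq {X Y Z : C} {a b c c' : ℕ} (α : Ext X Y a) (β : Ext Y Z b)
    (h : a + b = c) (h' : a + b = c') :
    (⟨c, α.comp β h⟩ : Σ n, Ext X Z n) = ⟨c', α.comp β h'⟩ := by
  subst h; subst h'; rfl

instance gOne (X : C) : GradedMonoid.GOne (fun n : ℕ => Ext X X n) where
  one := Ext.mk₀ (𝟙 X)

/-- The Yoneda product: `α * β` is the composition "first `β`, then `α`". -/
instance gMul (X : C) : GradedMonoid.GMul (fun n : ℕ => Ext X X n) where
  mul {i j} α β := β.comp α (add_comm j i)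

instance gSemiring (X : C) : DirectSum.GSemiring (fun n : ℕ => Ext X X n) where
  mul_zero α := Ext.zero_comp _ _ _ _ (add_comm _ _)
  zero_mul β := Ext.comp_zero _ _ _ _ (add_comm _ _)
  mul_add α β γ := Ext.add_comp _ _ _ _
  add_mul α β γ := Ext.comp_add _ _ _ _
  one_mul := fun ⟨i, α⟩ =>
    (mk_comp_eq α (Ext.mk₀ (𝟙 X)) (add_comm i 0) (add_zero i)).trans
      (congrArg (Sigma.mk i) (Ext.comp_mk₀_id α))
  mul_one := fun ⟨i, α⟩ =>
    (mk_comp_eq (Ext.mk₀ (𝟙 X)) α (add_comm 0 i) (zero_add i)).trans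
      (congrArg (Sigma.mk i) (Ext.mk₀_id_comp α))
  mul_assoc := fun ⟨i, α⟩ ⟨j, β⟩ ⟨l, γ⟩ =>
    (mk_comp_eq γ (β.comp α (add_comm j i)) (add_comm l (i + j))
        (show l + (i + j) = i + (j + l) by omega)).trans
      (congrArg (Sigma.mk (i + (j + l)))
        (Ext.comp_assoc γ β α (add_comm l j) (add_comm j i) (by omega)).symm)
  natCast m := m • Ext.mk₀ (𝟙 X)
  natCast_zero := zero_nsmul _
  natCast_succ m := succ_nsmul _ _

instance gAlgebra (k : Type*) [CommRing k] [Linear k C] (X : C) :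
    DirectSum.GAlgebra k (fun n : ℕ => Ext X X n) where
  toFun :=
    { toFun := fun r => r • Ext.mk₀ (𝟙 X)
      map_zero' := zero_smul _ _
      map_add' := fun r s => add_smul r s _ }
  map_one := one_smul _ _
  map_mul r s := by
    refine congrArg (Sigma.mk 0) ?_
    change (r * s) • Ext.mk₀ (𝟙 X) =
      (s • Ext.mk₀ (𝟙 X)).comp (r • Ext.mk₀ (𝟙 X)) (add_comm 0 0)
    rw [Ext.comp_smul, Ext.smul_comp, Ext.comp_mk₀_id, mul_smul]
  commutes := fun r ⟨i, α⟩ => by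
    refine (mk_comp_eq α (r • Ext.mk₀ (𝟙 X)) (add_comm i 0) (add_zero i)).trans
      (Eq.trans ?_ (mk_comp_eq (r • Ext.mk₀ (𝟙 X)) α (zero_add i) (add_comm 0 i)))
    rw [Ext.comp_smul, Ext.smul_comp, Ext.comp_mk₀_id, Ext.mk₀_id_comp]
  smul_def := fun r ⟨i, α⟩ => by
    refine Eq.trans ?_ (mk_comp_eq α (r • Ext.mk₀ (𝟙 X)) (add_zero i) (add_comm i 0))
    rw [Ext.comp_smul, Ext.comp_mk₀_id]
    rfl

end ExtAlg

/-- The Ext-algebra `Ext^*_Λ(S, S) = ⨁ i, Ext^i_Λ(S, S)` of a module `S` over a ring `Λ`, with the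
Yoneda product; it is a `k`-algebra if `Λ` is an algebra over the field `k`. -/
abbrev ExtAlgebra (Λ : Type u) [Ring Λ] (S : Type u) [AddCommGroup S] [Module Λ S] : Type u :=
  DirectSum ℕ fun i => Abelian.Ext.{u} (ModuleCat.of Λ S) (ModuleCat.of Λ S) i

/-- An element of the Ext-algebra is homogeneous of degree `d`, i.e. it lies in `Ext^d_Λ(S, S)`. -/
def ExtAlgebra.HasDegree {Λ : Type u} [Ring Λ] {S : Type u} [AddCommGroup S] [Module Λ S]
    (x : ExtAlgebra Λ S) (d : ℕ) : Prop :=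
  ∃ ξ : Abelian.Ext.{u} (ModuleCat.of Λ S) (ModuleCat.of Λ S) d, x = DirectSum.of _ d ξ

end

noncomputable section

/-! ### Cyclic presentations -/

/-! Write `t = s + 2`, let `α` be the sum of the arrows, `e a` the vertex idempotents, and `T =
Λ/Λα`. Every simple module is the summand of `T` cut out by right multiplication by some `e a`
(`exists_summand`), so `Ext(S,S)` is the corner of `Ext(T,T)` at `e a`, and it suffices to compute
the latter together with its idempotents.

Since `α` is normal and the left annihilators of `α` and `α^(s+1)` are `Λα^(s+1)` and `Λα`, there
are short exact sequences `0 → Λα → Λ → T → 0` and `0 → T → Λ → Λα → 0`. Splicing them gives a class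
`θ` of degree 2. As `Λ` is projective and `α` kills `T`, multiplication by `θ` is bijective in every
degree, including degree 0 (`theta_comp_bijective`). The projection of `Λα` onto its top gives a
class `β` of degree 1 with a bijection from degree 0 to degree 1 (`beta_comp_bijective`). Hence
`Ext(T,T)` is free over `End(T)` on the `θ^m` and `βθ^m`.

Naturality of extension classes yields the relations `θ e_a = e_(a+t) θ`, `β e_a = e_(a+1) β`, `βθ =
θβ`, and `β² = 0` for `t ≥ 3`, `β² = θ` for `t = 2`. Since `e_a End(T) e_b` is `k e_a` for `a = b`
and zero otherwise, the corner has dimension one in degree `2m` if `mt ≡ 0`, in degree `2m+1` if `mt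
+ 1 ≡ 0` modulo `n`, and is zero in all other degrees. The solutions of the first congruence are the
multiples of `l₁`; those of the second, if any, are `l₂` plus such multiples. The powers of `x`, and
their products with `y`, therefore form a basis. -/

/-- A `k`-algebra with an element `α` (the sum of the arrows) and idempotents `e a` satisfying the
properties of the selfinjective Nakayama algebra of Loewy length `s + 2` whose vertices are the
elements of a cyclic ring `V`. -/
structure CyclicPresentation (k : Type*) [Field k] {Λ : Type*} [Ring Λ] [Algebra k Λ] {V : Type*}
    [CommRing V] [Fintype V] (s : ℕ) (α : Λ) (e : V → Λ) : Prop where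
  sum_e : ∑ a, e a = 1
  e_mul_self : ∀ a, e a * e a = e a
  e_mul_of_ne : ∀ {a b}, a ≠ b → e a * e b = 0
  mul_e : ∀ a, α * e a = e (a + 1) * α
  pow_eq_zero : α ^ (s + 2) = 0
  exists_of_mul_eq_zero : ∀ {x : Λ}, x * α = 0 → ∃ y, x = y * α ^ (s + 1)
  exists_of_mul_pow_eq_zero : ∀ {x : Λ}, x * α ^ (s + 1) = 0 → ∃ y, x = y * α
  exists_mul_e : ∀ (x : Λ) a, ∃ (c : k) (y : Λ), x * e a = c • e a + y * α
  eq_zero_of_smul_e : ∀ {c : k} {a} {y : Λ}, c • e a = y * α → c = 0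

/-! ### The path algebra of the oriented cycle and the powers of its arrow ideal -/

namespace ATilde

variable {m : ℕ}

instance : CommRing (ATilde m) := inferInstanceAs (CommRing (ZMod (m + 1)))

/-- The arrow starting in the vertex `a`. -/
def arr (a : ATilde m) : a ⟶ next a := ⟨rfl⟩

theorem exists_path (a : ATilde m) (j : ℕ) :
    ∃ (b : ATilde m) (p : Quiver.Path a b), p.length = j := by
  induction j with
  | zero => exact ⟨a, .nil, rfl⟩
  | succ j ih =>
    obtain ⟨b, p, rfl⟩ := ih
    exact ⟨_, p.cons (arr b), rfl⟩

end ATilde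

namespace PathAlgebra

open ATilde

section

variable {k : Type w} [Field k] {V : Type u} [Quiver.{v} V]

theorem vertex_mul_self (a : V) : vertex k a * vertex k a = vertex k a :=
  ofPath_mul_ofPath _ _

theorem vertex_mul_of_ne {a b : V} (h : a ≠ b) : vertex k a * vertex k b = 0 :=
  ofPath_mul_ofPath_of_ne _ _ h.symm

end

variable (k : Type w) [Field k] {m : ℕ}

variable (m) in
/-- The sum of all arrows of the cyclic quiver. -/
def arrowSum : PathAlgebra k (ATilde m) := ∑ a : ATilde m, arrow k (arr a)

variable {k}

theorem arrowSum_mul_ofPath {a b : ATilde m} (p : Quiver.Path a b) :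
    arrowSum k m * ofPath k p = ofPath k (p.cons (arr b)) := by
  rw [arrowSum, Finset.sum_mul, Finset.sum_eq_single b]
  · exact ofPath_mul_ofPath _ _
  · exact fun c _ hc => ofPath_mul_ofPath_of_ne _ _ hc.symm
  · simp

theorem arrowSum_mul_vertex (a : ATilde m) :
    arrowSum k m * vertex k a = arrow k (arr a) := arrowSum_mul_ofPath _

theorem vertex_mul_arrowSum (a : ATilde m) :
    vertex k (a + 1) * arrowSum k m = arrow k (arr a) := by
  rw [arrowSum, Finset.mul_sum, Finset.sum_eq_single a]
  · exact ofPath_mul_ofPath _ _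
  · exact fun c _ hc => ofPath_mul_ofPath_of_ne _ _ fun h => hc (add_left_injective (1 : ATilde m) h)
  · simp

theorem arrowSum_mul_vertex' (a : ATilde m) :
    arrowSum k m * vertex k a = vertex k (a + 1) * arrowSum k m := by
  rw [arrowSum_mul_vertex, vertex_mul_arrowSum]

/-- On the cycle a path is determined by its source and its length, so the monomials `α^j e_a` are
exactly the path basis. -/
theorem ofPath_eq {a b : ATilde m} (p : Quiver.Path a b) :
    ofPath k p = arrowSum k m ^ p.length * vertex k a := by
  induction p with
  | nil => simp [vertex]
  | cons p e ih =>
    obtain ⟨rfl⟩ := e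
    rw [Quiver.Path.length_cons, pow_succ', mul_assoc, ← ih, arrowSum_mul_ofPath]
    rfl

theorem monomial_induction {P : PathAlgebra k (ATilde m) → Prop} (zero : P 0)
    (add : ∀ x y, P x → P y → P (x + y))
    (smul : ∀ (c : k) j a, P (c • (arrowSum k m ^ j * vertex k a))) (x) : P x := by
  refine Finsupp.induction_linear (motive := P) x zero add fun ⟨a, b, p⟩ c => ?_
  have h : (Finsupp.single ⟨a, b, p⟩ c : QuiverPath (ATilde m) →₀ k) =
      c • (ofPath k p : QuiverPath (ATilde m) →₀ k) :=
    (Finsupp.smul_single_one _ _).symm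
  rw [h]
  have := smul c p.length a
  rwa [← ofPath_eq] at this

open Classical in
/-- The coefficient of the path of length `j` starting in `a`. -/
def coeff (a : ATilde m) (j : ℕ) : PathAlgebra k (ATilde m) →ₗ[k] k :=
  liftPaths fun p => if p.1 = a ∧ p.2.2.length = j then 1 else 0

open Classical in
theorem coeff_monomial (a b : ATilde m) (i j : ℕ) :
    coeff a j (arrowSum k m ^ i * vertex k b) = if b = a ∧ i = j then 1 else 0 := by
  obtain ⟨c, p, rfl⟩ := exists_path b i
  rw [← ofPath_eq, coeff, liftPaths_ofPath]

theorem monomial_mul_arrowSum (a : ATilde m) (j : ℕ) :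
    arrowSum k m ^ j * vertex k a * arrowSum k m = arrowSum k m ^ (j + 1) * vertex k (a - 1) := by
  rw [pow_succ, mul_assoc, mul_assoc, arrowSum_mul_vertex', sub_add_cancel]

theorem coeff_zero_mul_arrowSum (a : ATilde m) (x : PathAlgebra k (ATilde m)) :
    coeff a 0 (x * arrowSum k m) = 0 := by
  induction x using monomial_induction with
  | zero => rw [zero_mul, map_zero]
  | add x y hx hy => rw [add_mul, map_add, hx, hy, add_zero]
  | smul c j b => rw [smul_mul_assoc, monomial_mul_arrowSum, map_smul, coeff_monomial]; simp

/-- Right multiplication by `α` prefixes the unique arrow `a → a + 1` to a path starting in `a + 1`.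
It is thus an injective shift of the path basis, from which the annihilators in the quotient are
read off. -/
theorem coeff_succ_mul_arrowSum (a : ATilde m) (j : ℕ) (x : PathAlgebra k (ATilde m)) :
    coeff a (j + 1) (x * arrowSum k m) = coeff (a + 1) j x := by
  induction x using monomial_induction with
  | zero => rw [zero_mul, map_zero, map_zero]
  | add x y hx hy => rw [add_mul, map_add, hx, hy, map_add]
  | smul c i b =>
    rw [smul_mul_assoc, monomial_mul_arrowSum, map_smul, map_smul, coeff_monomial, coeff_monomial]
    have h : (b - 1 = a ∧ i + 1 = j + 1) ↔ (b = a + 1 ∧ i = j) :=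
      and_congr sub_eq_iff_eq_add Nat.succ_inj
    by_cases h' : b = a + 1 ∧ i = j
    · rw [if_pos h', if_pos (h.2 h')]
    · rw [if_neg h', if_neg (mt h.1 h')]

theorem coeff_mul_pow_of_lt (x : PathAlgebra k (ATilde m)) {i j : ℕ} (h : j < i) (a : ATilde m) :
    coeff a j (x * arrowSum k m ^ i) = 0 := by
  induction i generalizing a j with
  | zero => omega
  | succ i ih =>
    rw [pow_succ, ← mul_assoc]
    cases j with
    | zero => exact coeff_zero_mul_arrowSum _ _
    | succ j => rw [coeff_succ_mul_arrowSum, ih (by omega)]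

theorem coeff_add_mul_pow (x : PathAlgebra k (ATilde m)) (i j : ℕ) (a : ATilde m) :
    coeff a (j + i) (x * arrowSum k m ^ i) = coeff (a + (i : ATilde m)) j x := by
  induction i generalizing a j with
  | zero => simp
  | succ i ih =>
    rw [pow_succ, ← mul_assoc, ← add_assoc, coeff_succ_mul_arrowSum, ih]
    push_cast
    rw [add_assoc, add_comm 1 (i : ATilde m)]

theorem exists_arrowSum_mul (z : PathAlgebra k (ATilde m)) :
    ∃ z', arrowSum k m * z = z' * arrowSum k m := by
  induction z using monomial_induction with
  | zero => exact ⟨0, by simp⟩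
  | add x y hx hy =>
    obtain ⟨x', hx⟩ := hx
    obtain ⟨y', hy⟩ := hy
    exact ⟨x' + y', by rw [mul_add, hx, hy, add_mul]⟩
  | smul c j a =>
    refine ⟨c • (arrowSum k m ^ j * vertex k (a + 1)), ?_⟩
    rw [mul_smul_comm, smul_mul_assoc, ← mul_assoc, ← pow_succ', pow_succ, mul_assoc, mul_assoc,
      arrowSum_mul_vertex']

theorem exists_pow_arrowSum_mul (j : ℕ) (z : PathAlgebra k (ATilde m)) :
    ∃ z', arrowSum k m ^ j * z = z' * arrowSum k m ^ j := by
  induction j generalizing z with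
  | zero => exact ⟨z, by simp⟩
  | succ j ih =>
    obtain ⟨y, hy⟩ := exists_arrowSum_mul z
    obtain ⟨x, hx⟩ := ih y
    exact ⟨x, by rw [pow_succ, mul_assoc, hy, ← mul_assoc, hx, mul_assoc]⟩

theorem exists_eq_sum_add (x : PathAlgebra k (ATilde m)) (j : ℕ) :
    ∃ y, x = ∑ i ∈ Finset.range j, ∑ a, coeff a i x • (arrowSum k m ^ i * vertex k a) +
      y * arrowSum k m ^ j := by
  classical
  induction x using monomial_induction with
  | zero => exact ⟨0, by simp⟩
  | add x y hx hy =>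
    obtain ⟨x', hx⟩ := hx
    obtain ⟨y', hy⟩ := hy
    refine ⟨x' + y', ?_⟩
    conv_lhs => rw [hx, hy]
    simp only [map_add, add_smul, Finset.sum_add_distrib, add_mul]
    abel
  | smul c l b =>
    have key : ∀ i, ∑ a, coeff a i (c • (arrowSum k m ^ l * vertex k b)) •
        (arrowSum k m ^ i * vertex k a) =
        if l = i then c • (arrowSum k m ^ l * vertex k b) else 0 := by
      intro i
      rw [Finset.sum_eq_single b]
      · rw [map_smul, coeff_monomial]
        by_cases h : l = i
        · subst h; simp
        · simp [h]
      · intro a _ ha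
        rw [map_smul, coeff_monomial, if_neg (fun h => ha h.1.symm), smul_zero, zero_smul]
      · simp
    simp only [key]
    by_cases h : l < j
    · refine ⟨0, ?_⟩
      rw [Finset.sum_ite_eq, if_pos (Finset.mem_range.2 h), zero_mul, add_zero]
    · obtain ⟨d, rfl⟩ := Nat.exists_eq_add_of_le (not_lt.1 h)
      obtain ⟨z, hz⟩ := exists_pow_arrowSum_mul j (arrowSum k m ^ d * vertex k b)
      refine ⟨c • z, ?_⟩
      rw [Finset.sum_ite_eq, if_neg (by simp), zero_add, smul_mul_assoc, ← hz, ← mul_assoc, pow_add]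

theorem exists_eq_mul_pow {x : PathAlgebra k (ATilde m)} {j : ℕ}
    (h : ∀ a, ∀ i < j, coeff a i x = 0) : ∃ y, x = y * arrowSum k m ^ j := by
  obtain ⟨y, hy⟩ := exists_eq_sum_add x j
  refine ⟨y, hy.trans ?_⟩
  rw [Finset.sum_eq_zero, zero_add]
  intro i hi
  exact Finset.sum_eq_zero fun a _ => by rw [h a i (Finset.mem_range.1 hi), zero_smul]

variable (k m) in
/-- The multiples of the sum of all arrows form a two-sided ideal. -/
def arrowSumIdeal : TwoSidedIdeal (PathAlgebra k (ATilde m)) :=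
  TwoSidedIdeal.mk' {x | ∃ y, x = y * arrowSum k m} ⟨0, by simp⟩
    (by rintro _ _ ⟨x, rfl⟩ ⟨y, rfl⟩; exact ⟨x + y, (add_mul _ _ _).symm⟩)
    (by rintro _ ⟨x, rfl⟩; exact ⟨-x, (neg_mul _ _).symm⟩)
    (by rintro z _ ⟨x, rfl⟩; exact ⟨z * x, (mul_assoc _ _ _).symm⟩)
    (by
      rintro _ z ⟨x, rfl⟩
      obtain ⟨z', hz⟩ := exists_arrowSum_mul z
      exact ⟨x * z', by rw [mul_assoc, hz, mul_assoc]⟩)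

theorem mem_arrowIdeal {x : PathAlgebra k (ATilde m)} :
    x ∈ arrowIdeal k (ATilde m) ↔ ∃ y, x = y * arrowSum k m := by
  rw [arrowIdeal, TwoSidedIdeal.mem_asIdeal]
  constructor
  · intro hx
    have h : TwoSidedIdeal.span {x | ∃ (a b : ATilde m) (e : a ⟶ b), x = arrow k e} ≤
        arrowSumIdeal k m := by
      rw [TwoSidedIdeal.span_le]
      rintro _ ⟨a, b, ⟨rfl⟩, rfl⟩
      rw [SetLike.mem_coe, arrowSumIdeal, TwoSidedIdeal.mem_mk']
      exact ⟨vertex k (a + 1), (vertex_mul_arrowSum a).symm⟩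
    have := h hx
    rwa [arrowSumIdeal, TwoSidedIdeal.mem_mk'] at this
  · rintro ⟨y, rfl⟩
    refine TwoSidedIdeal.mul_mem_left _ _ _ (sum_mem fun a _ => TwoSidedIdeal.subset_span ?_)
    exact ⟨_, _, _, rfl⟩

/-- The arrow ideal is `Aα`, where `A` is the path algebra. Because `α^t A ⊆ A α^t`, all factors `α`
in a product of elements of `Aα` can be collected on the right. -/
theorem mem_arrowIdeal_pow {x : PathAlgebra k (ATilde m)} {t : ℕ} :
    x ∈ arrowIdeal k (ATilde m) ^ t ↔ ∃ y, x = y * arrowSum k m ^ t := by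
  induction t generalizing x with
  | zero => simp [Submodule.pow_zero]
  | succ t ih =>
    constructor
    · intro hx
      rw [Submodule.pow_succ] at hx
      refine Submodule.mul_induction_on hx ?_ ?_
      · intro y hy z hz
        obtain ⟨y, rfl⟩ := ih.1 hy
        obtain ⟨z, rfl⟩ := mem_arrowIdeal.1 hz
        obtain ⟨w, hw⟩ := exists_pow_arrowSum_mul t z
        exact ⟨y * w, by rw [pow_succ, mul_assoc, ← mul_assoc _ z, hw]; simp only [mul_assoc]⟩
      · rintro _ _ ⟨x, rfl⟩ ⟨y, rfl⟩
        exact ⟨x + y, (add_mul _ _ _).symm⟩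
    · rintro ⟨y, rfl⟩
      rw [pow_succ, Submodule.pow_succ, ← mul_assoc]
      exact Submodule.mul_mem_mul (ih.2 ⟨y, rfl⟩) (mem_arrowIdeal.2 ⟨1, (one_mul _).symm⟩)

end PathAlgebra

/-! ### The Nakayama algebra satisfies the cyclic presentation -/

namespace NakayamaAlgebra

open PathAlgebra

/-- The annihilator conditions are a count of path lengths: if `xα^i` lies in `Aα^(s+2)`, the shift
of coefficients shows that `x` has no paths of length less than `s + 2 - i`, hence `x` lies in
`Aα^(s+2-i)`. -/
theorem cyclicPresentation (k : Type u) [Field k] (m s : ℕ) :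
    CyclicPresentation k (Λ := PathAlgebra k (ATilde m) ⧸ arrowIdeal k (ATilde m) ^ (s + 2)) s
      (Ideal.Quotient.mk _ (arrowSum k m)) (fun a : ATilde m => Ideal.Quotient.mk _ (vertex k a))
      where
  sum_e := by rw [← map_sum]; exact map_one _
  e_mul_self a := by rw [← map_mul, vertex_mul_self]
  e_mul_of_ne h := by rw [← map_mul, vertex_mul_of_ne h, map_zero]
  mul_e a := by
    rw [← map_mul, ← map_mul]
    exact congrArg _ (arrowSum_mul_vertex' (m := m) a)
  pow_eq_zero := by
    rw [← map_pow, Ideal.Quotient.eq_zero_iff_mem]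
    exact mem_arrowIdeal_pow.2 ⟨1, (one_mul _).symm⟩
  exists_of_mul_eq_zero {x} h := by
    obtain ⟨x, rfl⟩ := Ideal.Quotient.mk_surjective x
    rw [← map_mul, Ideal.Quotient.eq_zero_iff_mem] at h
    obtain ⟨z, hz⟩ := mem_arrowIdeal_pow.1 h
    obtain ⟨y, rfl⟩ := exists_eq_mul_pow (x := x) (j := s + 1) fun a i hi => by
      have := coeff_succ_mul_arrowSum (a - 1) i x
      rwa [hz, coeff_mul_pow_of_lt _ (by omega), sub_add_cancel, eq_comm] at this
    exact ⟨Ideal.Quotient.mk _ y, by rw [map_mul, map_pow]⟩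
  exists_of_mul_pow_eq_zero {x} h := by
    obtain ⟨x, rfl⟩ := Ideal.Quotient.mk_surjective x
    rw [← map_pow, ← map_mul, Ideal.Quotient.eq_zero_iff_mem] at h
    obtain ⟨z, hz⟩ := mem_arrowIdeal_pow.1 h
    obtain ⟨y, rfl⟩ := exists_eq_mul_pow (x := x) (j := 1) fun a i hi => by
      have := coeff_add_mul_pow x (s + 1) i (a - ((s + 1 : ℕ) : ATilde m))
      rwa [hz, coeff_mul_pow_of_lt _ (by omega), sub_add_cancel, eq_comm] at this
    exact ⟨Ideal.Quotient.mk _ y, by rw [map_mul, pow_one]⟩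
  exists_mul_e x a := by
    obtain ⟨x, rfl⟩ := Ideal.Quotient.mk_surjective x
    suffices h : ∃ (c : k) (y : _), x * vertex k a =
        c • vertex k a + y * arrowSum k m by
      obtain ⟨c, y, h⟩ := h
      exact ⟨c, Ideal.Quotient.mk _ y, by rw [← map_mul, h, map_add, map_mul]; rfl⟩
    induction x using monomial_induction with
    | zero => exact ⟨0, 0, by simp⟩
    | add x y hx hy =>
      obtain ⟨c, x', hx⟩ := hx
      obtain ⟨d, y', hy⟩ := hy
      exact ⟨c + d, x' + y', by rw [add_mul, hx, hy, add_smul, add_mul]; abel⟩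
    | smul c j b =>
      by_cases hb : b = a
      · subst hb
        cases j with
        | zero => exact ⟨c, 0, by simp [vertex_mul_self]⟩
        | succ j =>
          refine ⟨0, c • (arrowSum k m ^ j * vertex k (b + 1)), ?_⟩
          rw [smul_mul_assoc, smul_mul_assoc, mul_assoc, vertex_mul_self, pow_succ, mul_assoc,
            arrowSum_mul_vertex', zero_smul, zero_add, mul_assoc]
      · exact ⟨0, 0, by rw [smul_mul_assoc, mul_assoc, vertex_mul_of_ne hb]; simp⟩
  eq_zero_of_smul_e {c a y} h := by
    obtain ⟨y, rfl⟩ := Ideal.Quotient.mk_surjective y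
    have h' : Ideal.Quotient.mk (arrowIdeal k (ATilde m) ^ (s + 2))
        (c • vertex k a - y * arrowSum k m) = 0 := by
      rw [map_sub, map_mul, ← h]
      exact sub_self _
    rw [Ideal.Quotient.eq_zero_iff_mem] at h'
    obtain ⟨z, hz⟩ := mem_arrowIdeal_pow.1 h'
    have h1 := congrArg (coeff (m := m) a 0) hz
    rw [coeff_mul_pow_of_lt _ (by omega), map_sub, coeff_zero_mul_arrowSum, sub_zero, map_smul] at h1
    have h2 := coeff_monomial (k := k) (m := m) a a 0 0
    rw [pow_zero, one_mul] at h2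
    simpa [h2] using h1

end NakayamaAlgebra

/-! ### Connecting homomorphisms of dimension shifting -/

section DimensionShift

open Abelian

variable {C : Type u} [Category.{v} C] [Abelian C] [HasExt.{w} C]

/-- In the long exact sequence for `Ext(-, Y)` the positive degrees of the projective middle term
vanish. The hypothesis `hY` kills the image of `Hom(X₂, Y)` in `Hom(X₁, Y)`, which extends the
bijection to `n = 0`. -/
theorem CategoryTheory.ShortComplex.ShortExact.extClass_comp_bijective {S : ShortComplex C}
    (hS : S.ShortExact) [Projective S.X₂] {Y : C} (hY : ∀ g : S.X₂ ⟶ Y, S.f ≫ g = 0) {n m : ℕ}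
    (h : 1 + n = m) :
    Function.Bijective fun x : Ext S.X₁ Y n => hS.extClass.comp x h := by
  constructor
  · intro x y hxy
    rw [← sub_eq_zero]
    have h0 : hS.extClass.comp (x - y) h = 0 := by
      rw [sub_eq_add_neg, Ext.comp_add, Ext.comp_neg, ← sub_eq_add_neg, sub_eq_zero]
      exact hxy
    obtain ⟨z, hz⟩ := Ext.contravariant_sequence_exact₁ hS Y _ h h0
    rw [← hz]
    cases n with
    | zero =>
      obtain ⟨g, rfl⟩ := Ext.mk₀_bijective _ _ |>.2 z
      rw [Ext.mk₀_comp_mk₀, hY, Ext.mk₀_zero]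
    | succ n => rw [Ext.eq_zero_of_projective z, Ext.comp_zero]
  · intro x
    obtain rfl : m = n + 1 := by omega
    exact Ext.contravariant_sequence_exact₃ hS Y x (Ext.eq_zero_of_projective _) h

end DimensionShift

/-! ### Cyclic modules -/

section CyclicModules

variable {Λ : Type u} [Ring Λ] (α : Λ)

/-- The quotient of the regular module by the left ideal generated by `α`. -/
abbrev TopModule : Type u := Λ ⧸ Submodule.span Λ {α}

/-- The left ideal generated by `α`. -/
abbrev RadModule : Type u := Submodule.span Λ {α}

namespace TopModule

variable {M : Type*} [AddCommGroup M] [Module Λ M]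

/-- The quotient map. -/
abbrev mk : Λ →ₗ[Λ] TopModule α := (Submodule.span Λ {α}).mkQ

theorem mk_surjective : Function.Surjective (mk α) := Submodule.mkQ_surjective _

variable {α}

theorem mk_eq_zero {x : Λ} : mk α x = 0 ↔ ∃ y, x = y * α := by
  rw [Submodule.mkQ_apply, Submodule.Quotient.mk_eq_zero, Submodule.mem_span_singleton]
  exact exists_congr fun _ => eq_comm

/-- The linear map out of `Λ ⧸ Λ α` given by an element killed by `α`. -/
def lift (m : M) (hm : α • m = 0) : TopModule α →ₗ[Λ] M :=
  Submodule.liftQSpanSingleton α (LinearMap.toSpanSingleton Λ M m) hm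

theorem lift_mk (m : M) (hm : α • m = 0) (x : Λ) : lift m hm (mk α x) = x • m := rfl

theorem hom_ext {f g : TopModule α →ₗ[Λ] M} (h : ∀ x, f (mk α x) = g (mk α x)) : f = g :=
  Submodule.linearMap_qext _ (LinearMap.ext h)

end TopModule

namespace RadModule

variable {M : Type*} [AddCommGroup M] [Module Λ M]

/-- Right multiplication by `α`. -/
def mk : Λ →ₗ[Λ] RadModule α :=
  LinearMap.toSpanSingleton Λ _ ⟨α, Submodule.mem_span_singleton_self α⟩

theorem coe_mk (x : Λ) : (mk α x : Λ) = x * α := rfl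

theorem mk_surjective : Function.Surjective (mk α) := by
  rintro ⟨y, hy⟩
  obtain ⟨x, rfl⟩ := Submodule.mem_span_singleton.1 hy
  exact ⟨x, rfl⟩

variable {α}

theorem mk_eq_zero {x : Λ} : mk α x = 0 ↔ x * α = 0 := by
  rw [← coe_mk, ZeroMemClass.coe_eq_zero]

/-- The linear map out of `Λ α` given by an element killed by the annihilator of `α`. -/
def lift (m : M) (hm : ∀ x, x * α = 0 → x • m = 0) : RadModule α →ₗ[Λ] M :=
  ((mk α).ker.liftQ (LinearMap.toSpanSingleton Λ M m) fun x hx => hm x (mk_eq_zero.1 hx)).comp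
    ((mk α).quotKerEquivOfSurjective (mk_surjective α)).symm.toLinearMap

theorem lift_mk (m : M) (hm : ∀ x, x * α = 0 → x • m = 0) (x : Λ) :
    lift m hm (mk α x) = x • m := by
  rw [lift, LinearMap.comp_apply, LinearEquiv.coe_coe, LinearMap.quotKerEquivOfSurjective_symm_apply]
  rfl

theorem hom_ext {f g : RadModule α →ₗ[Λ] M} (h : ∀ x, f (mk α x) = g (mk α x)) : f = g :=
  LinearMap.ext fun y => by
    obtain ⟨x, rfl⟩ := mk_surjective α y
    exact h x

end RadModule

end CyclicModules

/-! ### The two syzygy sequences, the classes `θ` and `β`, and their relations -/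

namespace CyclicPresentation

open Abelian

variable {k : Type u} [Field k] {Λ : Type u} [Ring Λ] [Algebra k Λ] {V : Type} [CommRing V]
  [Fintype V] {s : ℕ} {α : Λ} {e : V → Λ} (h : CyclicPresentation k s α e)

include h

/-- Modulo `Λα` each `x e_a` is a scalar multiple of `e_a`, and `α` moves past `e_a`. So `Λα` is a
two-sided ideal and `α` annihilates `T`. -/
theorem exists_mul (x : Λ) : ∃ y, α * x = y * α := by
  have hx : ∀ a, ∃ y, α * (x * e a) = y * α := by
    intro a
    obtain ⟨c, y, hy⟩ := h.exists_mul_e x a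
    exact ⟨c • e (a + 1) + α * y, by
      rw [hy, mul_add, mul_smul_comm, h.mul_e, add_mul, smul_mul_assoc, mul_assoc]⟩
  choose y hy using hx
  refine ⟨∑ a, y a, ?_⟩
  rw [Finset.sum_mul, ← Finset.sum_congr rfl fun a _ => hy a, ← Finset.mul_sum, ← Finset.mul_sum,
    h.sum_e, mul_one]

theorem smul_top (x : TopModule α) : α • x = 0 := by
  obtain ⟨x, rfl⟩ := TopModule.mk_surjective α x
  rw [← map_smul, TopModule.mk_eq_zero]
  exact h.exists_mul x

theorem pow_mul_e (j : ℕ) (a : V) : α ^ j * e a = e (a + j) * α ^ j := by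
  induction j generalizing a with
  | zero => simp
  | succ j ih =>
    rw [pow_succ, mul_assoc, h.mul_e, ← mul_assoc, ih, mul_assoc]
    push_cast
    rw [add_assoc, add_comm (1 : V)]

/-- The inclusion of the top as the socle of the regular module. -/
def topToReg : TopModule α →ₗ[Λ] Λ :=
  TopModule.lift (α ^ (s + 1)) (by rw [smul_eq_mul, ← pow_succ', h.pow_eq_zero])

theorem topToReg_mk (x : Λ) : h.topToReg (TopModule.mk α x) = x * α ^ (s + 1) := rfl

/-- The projection of the radical onto its top. -/
def radToTop : RadModule α →ₗ[Λ] TopModule α :=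
  RadModule.lift (TopModule.mk α 1) fun x hx => by
    obtain ⟨y, rfl⟩ := h.exists_of_mul_eq_zero hx
    rw [← map_smul, smul_eq_mul, mul_one, TopModule.mk_eq_zero]
    exact ⟨y * α ^ s, by rw [mul_assoc, pow_succ]⟩

theorem radToTop_mk (x : Λ) : h.radToTop (RadModule.mk α x) = TopModule.mk α x := by
  rw [radToTop, RadModule.lift_mk, ← map_smul, smul_eq_mul, mul_one]

/-- The inclusion of the top as the socle of the radical. -/
def topToRad : TopModule α →ₗ[Λ] RadModule α :=
  TopModule.lift (RadModule.mk α (α ^ s)) (by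
    rw [← map_smul, RadModule.mk_eq_zero, smul_eq_mul, ← pow_succ', ← pow_succ, h.pow_eq_zero])

theorem topToRad_mk (x : Λ) : h.topToRad (TopModule.mk α x) = RadModule.mk α (x * α ^ s) := by
  rw [topToRad, TopModule.lift_mk, ← map_smul, smul_eq_mul]

/-- Right multiplication by an idempotent on the top. -/
def topMul (a : V) : TopModule α →ₗ[Λ] TopModule α := TopModule.lift (TopModule.mk α (e a)) (h.smul_top _)

theorem topMul_mk (a : V) (x : Λ) : h.topMul a (TopModule.mk α x) = TopModule.mk α (x * e a) := by
  rw [topMul, TopModule.lift_mk, ← map_smul, smul_eq_mul]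

/-- Right multiplication by an idempotent on the radical. -/
def radMul (a : V) : RadModule α →ₗ[Λ] RadModule α :=
  RadModule.lift (RadModule.mk α (e (a + 1))) fun x hx => by
    rw [← map_smul, RadModule.mk_eq_zero, smul_eq_mul, mul_assoc, ← h.mul_e, ← mul_assoc, hx, zero_mul]

theorem radMul_mk (a : V) (x : Λ) :
    h.radMul a (RadModule.mk α x) = RadModule.mk α (x * e (a + 1)) := by
  rw [radMul, RadModule.lift_mk, ← map_smul, smul_eq_mul]

omit h in
variable (α) in
/-- The short complex `Λ α → Λ → Λ ⧸ Λ α`. -/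
abbrev radTopComplex : ShortComplex (ModuleCat.{u} Λ) :=
  ShortComplex.mk (ModuleCat.ofHom (Submodule.span Λ {α}).subtype)
    (ModuleCat.ofHom (TopModule.mk α)) (by
      ext x
      exact (Submodule.Quotient.mk_eq_zero _).2 x.2)

omit h in
variable (α) in
theorem radTop_shortExact : (radTopComplex α).ShortExact :=
  ModuleCat.shortComplex_shortExact _
    (LinearMap.exact_iff.2 (by simp))
    (Submodule.subtype_injective _) (TopModule.mk_surjective α)

/-- The short complex `Λ ⧸ Λ α → Λ → Λ α`. -/
abbrev topRadComplex : ShortComplex (ModuleCat.{u} Λ) :=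
  ShortComplex.mk (ModuleCat.ofHom h.topToReg) (ModuleCat.ofHom (RadModule.mk α)) (by
    refine ModuleCat.hom_ext (TopModule.hom_ext fun x => ?_)
    change RadModule.mk α (h.topToReg (TopModule.mk α x)) = 0
    rw [topToReg_mk, RadModule.mk_eq_zero, mul_assoc, ← pow_succ, h.pow_eq_zero, mul_zero])

theorem topRad_shortExact : h.topRadComplex.ShortExact := by
  refine ModuleCat.shortComplex_shortExact _ (fun x => ?_) ?_ (RadModule.mk_surjective α)
  · change RadModule.mk α x = 0 ↔ ∃ y, h.topToReg y = x
    rw [RadModule.mk_eq_zero]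
    constructor
    · intro hx
      obtain ⟨y, rfl⟩ := h.exists_of_mul_eq_zero hx
      exact ⟨TopModule.mk α y, rfl⟩
    · rintro ⟨y, rfl⟩
      obtain ⟨y, rfl⟩ := TopModule.mk_surjective α y
      rw [topToReg_mk, mul_assoc, ← pow_succ, h.pow_eq_zero, mul_zero]
  · change Function.Injective h.topToReg
    refine (injective_iff_map_eq_zero _).2 fun y hy => ?_
    obtain ⟨y, rfl⟩ := TopModule.mk_surjective α y
    exact TopModule.mk_eq_zero.2 (h.exists_of_mul_pow_eq_zero hy)

omit h in
variable (α) in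
/-- The module `Λ ⧸ Λ α` as an object. -/
abbrev top : ModuleCat.{u} Λ := ModuleCat.of Λ (TopModule α)

omit h in
variable (α) in
/-- The module `Λ α` as an object. -/
abbrev rad : ModuleCat.{u} Λ := ModuleCat.of Λ (RadModule α)

omit h in
variable (α) in
/-- The class of `Λ α → Λ → Λ ⧸ Λ α`. -/
def extTopRad : Ext.{u} (top α) (rad α) 1 := (radTop_shortExact α).extClass

/-- The class of `Λ ⧸ Λ α → Λ → Λ α`. -/
def extRadTop : Ext.{u} (rad α) (top α) 1 := h.topRad_shortExact.extClass

/-- Naturality for the map from the second syzygy sequence to the first that is the identity on `Λ`.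
-/
theorem radToTop_comp_extTopRad :
    (Ext.mk₀ (ModuleCat.ofHom h.radToTop)).comp (extTopRad α) (zero_add 1) =
      h.extRadTop.comp (Ext.mk₀ (ModuleCat.ofHom h.topToRad)) (add_zero 1) := by
  refine (ShortComplex.ShortExact.extClass_naturality h.topRad_shortExact (radTop_shortExact α)
    { τ₁ := ModuleCat.ofHom h.topToRad
      τ₂ := 𝟙 _
      τ₃ := ModuleCat.ofHom h.radToTop
      comm₁₂ := ModuleCat.hom_ext (TopModule.hom_ext fun x => ?_)
      comm₂₃ := ModuleCat.hom_ext (LinearMap.ext fun x => ?_) }).symm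
  · change (h.topToRad (TopModule.mk α x) : Λ) = h.topToReg (TopModule.mk α x)
    rw [topToRad_mk, topToReg_mk, RadModule.coe_mk, mul_assoc, pow_succ]
  · exact (h.radToTop_mk x).symm

/-- Naturality for the map from the first syzygy sequence to the second that is right multiplication
by `α^s` on `Λ`. -/
theorem topToRad_comp_extRadTop :
    (Ext.mk₀ (ModuleCat.ofHom h.topToRad)).comp h.extRadTop (zero_add 1) =
      (extTopRad α).comp (Ext.mk₀ (ModuleCat.ofHom h.radToTop)) (add_zero 1) := by
  refine (ShortComplex.ShortExact.extClass_naturality (radTop_shortExact α) h.topRad_shortExact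
    { τ₁ := ModuleCat.ofHom h.radToTop
      τ₂ := ModuleCat.ofHom (LinearMap.toSpanSingleton Λ Λ (α ^ s))
      τ₃ := ModuleCat.ofHom h.topToRad
      comm₁₂ := ModuleCat.hom_ext (RadModule.hom_ext fun x => ?_)
      comm₂₃ := ModuleCat.hom_ext (LinearMap.ext fun x => ?_) }).symm
  · change h.topToReg (h.radToTop (RadModule.mk α x)) = x * α * α ^ s
    rw [radToTop_mk, topToReg_mk, mul_assoc, pow_succ']
  · exact (h.topToRad_mk x).symm

theorem topMul_comp_extTopRad (a : V) :
    (Ext.mk₀ (ModuleCat.ofHom (h.topMul a))).comp (extTopRad α) (zero_add 1) =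
      (extTopRad α).comp (Ext.mk₀ (ModuleCat.ofHom (h.radMul a))) (add_zero 1) := by
  refine (ShortComplex.ShortExact.extClass_naturality (radTop_shortExact α) (radTop_shortExact α)
    { τ₁ := ModuleCat.ofHom (h.radMul a)
      τ₂ := ModuleCat.ofHom (LinearMap.toSpanSingleton Λ Λ (e a))
      τ₃ := ModuleCat.ofHom (h.topMul a)
      comm₁₂ := ModuleCat.hom_ext (RadModule.hom_ext fun x => ?_)
      comm₂₃ := ModuleCat.hom_ext (LinearMap.ext fun x => ?_) }).symm
  · change (h.radMul a (RadModule.mk α x) : Λ) = x * α * e a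
    rw [radMul_mk, RadModule.coe_mk, mul_assoc, mul_assoc, h.mul_e]
  · exact h.topMul_mk a x

/-- On `Λα` the idempotent acts through `xα e_a = x e_(a+1) α`. Passing `e_(a+1)` through the socle
inclusion `x ↦ xα^(s+1)` shifts the index by another `s + 1`, for a total of `t = s + 2`. -/
theorem radMul_comp_extRadTop (a : V) :
    (Ext.mk₀ (ModuleCat.ofHom (h.radMul a))).comp h.extRadTop (zero_add 1) =
      h.extRadTop.comp (Ext.mk₀ (ModuleCat.ofHom (h.topMul (a + (s + 2 : ℕ))))) (add_zero 1) := by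
  refine (ShortComplex.ShortExact.extClass_naturality h.topRad_shortExact h.topRad_shortExact
    { τ₁ := ModuleCat.ofHom (h.topMul (a + (s + 2 : ℕ)))
      τ₂ := ModuleCat.ofHom (LinearMap.toSpanSingleton Λ Λ (e (a + 1)))
      τ₃ := ModuleCat.ofHom (h.radMul a)
      comm₁₂ := ModuleCat.hom_ext (TopModule.hom_ext fun x => ?_)
      comm₂₃ := ModuleCat.hom_ext (LinearMap.ext fun x => ?_) }).symm
  · change h.topToReg (h.topMul _ (TopModule.mk α x)) = h.topToReg (TopModule.mk α x) * e (a + 1)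
    rw [topMul_mk, topToReg_mk, topToReg_mk, mul_assoc, mul_assoc, h.pow_mul_e]
    push_cast
    ring_nf
  · exact (h.radMul_mk a x).symm

theorem radMul_radToTop (a : V) :
    h.radToTop ∘ₗ h.radMul a = h.topMul (a + 1) ∘ₗ h.radToTop :=
  RadModule.hom_ext fun x => by
    rw [LinearMap.comp_apply, LinearMap.comp_apply, radMul_mk, radToTop_mk, radToTop_mk, topMul_mk]

/-- The composite is right multiplication by `α^s` on `Λ/Λα`. This is where `t ≥ 3` and `t = 2`
diverge. -/
theorem radToTop_topToRad_of_ne (hs : s ≠ 0) : h.radToTop ∘ₗ h.topToRad = 0 :=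
  TopModule.hom_ext fun x => by
    rw [LinearMap.comp_apply, topToRad_mk, radToTop_mk]
    obtain ⟨s, rfl⟩ := Nat.exists_eq_succ_of_ne_zero hs
    exact TopModule.mk_eq_zero.2 ⟨x * α ^ s, by rw [mul_assoc, pow_succ]⟩

theorem radToTop_topToRad_of_eq (hs : s = 0) : h.radToTop ∘ₗ h.topToRad = LinearMap.id :=
  TopModule.hom_ext fun x => by
    subst hs
    rw [LinearMap.comp_apply, topToRad_mk, radToTop_mk, pow_zero, mul_one, LinearMap.id_apply]

/-- Since `α` kills `T`, no map `Λ → T` detects `Λα`; this supplies the degree-zero hypothesis of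
the dimension shift for both sequences. -/
theorem reg_hom_top (g : ModuleCat.of Λ Λ ⟶ top α) {x : Λ} (hx : ∃ y, x = y * α) : g.hom x = 0 := by
  obtain ⟨y, rfl⟩ := hx
  have : g.hom (y * α) = (y * α) • g.hom 1 := by
    rw [← map_smul, smul_eq_mul, mul_one]
  rw [this, mul_smul, h.smul_top, smul_zero]

theorem extTopRad_comp_bijective {n m : ℕ} (hnm : 1 + n = m) :
    Function.Bijective fun x : Ext.{u} (rad α) (top α) n => (extTopRad α).comp x hnm := by
  have : Projective (radTopComplex α).X₂ := inferInstanceAs (Projective (ModuleCat.of Λ Λ))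
  refine (radTop_shortExact α).extClass_comp_bijective (fun g => ModuleCat.hom_ext ?_) hnm
  refine RadModule.hom_ext fun x => ?_
  exact h.reg_hom_top g ⟨x, rfl⟩

theorem extRadTop_comp_bijective {n m : ℕ} (hnm : 1 + n = m) :
    Function.Bijective fun x : Ext.{u} (top α) (top α) n => h.extRadTop.comp x hnm := by
  have : Projective h.topRadComplex.X₂ := inferInstanceAs (Projective (ModuleCat.of Λ Λ))
  refine h.topRad_shortExact.extClass_comp_bijective (fun g => ModuleCat.hom_ext ?_) hnm
  refine TopModule.hom_ext fun x => ?_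
  exact h.reg_hom_top g ⟨x * α ^ s, (h.topToReg_mk x).trans (by rw [pow_succ, mul_assoc])⟩

/-- The periodicity class. -/
def theta : Ext.{u} (top α) (top α) 2 := (extTopRad α).comp h.extRadTop rfl

/-- The class of degree one given by the arrows. -/
def beta : Ext.{u} (top α) (top α) 1 :=
  (extTopRad α).comp (Ext.mk₀ (ModuleCat.ofHom h.radToTop)) (add_zero 1)

theorem theta_comp_bijective (n : ℕ) :
    Function.Bijective fun x : Ext.{u} (top α) (top α) n => h.theta.comp x (add_comm 2 n) := by
  have := (h.extTopRad_comp_bijective (show 1 + (n + 1) = n + 2 by omega)).comp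
    (h.extRadTop_comp_bijective (show 1 + n = n + 1 by omega))
  convert this using 1
  funext x
  exact Ext.comp_assoc _ _ _ rfl (by omega) (by omega)

/-- Every map `Λα → T` kills `Λα²` and so factors uniquely through the top of `Λα`, which is `T`.
The dimension shift then carries degree 0 to degree 1. -/
theorem beta_comp_bijective :
    Function.Bijective fun x : Ext.{u} (top α) (top α) 0 => h.beta.comp x (add_zero 1) := by
  have hb : Function.Bijective fun x : Ext.{u} (top α) (top α) 0 =>
      (Ext.mk₀ (ModuleCat.ofHom h.radToTop)).comp x (zero_add 0) := by
    constructor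
    · have : Epi (ModuleCat.ofHom h.radToTop) := by
        rw [ModuleCat.epi_iff_surjective]
        intro x
        obtain ⟨x, rfl⟩ := TopModule.mk_surjective α x
        exact ⟨_, h.radToTop_mk x⟩
      exact Ext.precomp_mk₀_injective_of_epi _ (ModuleCat.ofHom h.radToTop)
    · intro y
      obtain ⟨g, rfl⟩ := (Ext.mk₀_bijective _ _).2 y
      refine ⟨Ext.mk₀ (ModuleCat.ofHom (TopModule.lift (g.hom (RadModule.mk α 1)) (h.smul_top _))), ?_⟩
      change Ext.comp _ _ _ = _
      rw [Ext.mk₀_comp_mk₀]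
      refine congrArg _ (ModuleCat.hom_ext (RadModule.hom_ext fun x => ?_))
      change TopModule.lift (g.hom (RadModule.mk α 1)) (h.smul_top _) (h.radToTop (RadModule.mk α x)) = g.hom (RadModule.mk α x)
      rw [radToTop_mk, TopModule.lift_mk, ← map_smul, ← map_smul, smul_eq_mul, mul_one]
  have := (h.extTopRad_comp_bijective (add_zero 1)).comp hb
  convert this using 1
  funext x
  exact Ext.comp_assoc _ _ _ (add_zero 1) (zero_add 0) rfl

theorem topMul_comp_theta (a : V) :
    (Ext.mk₀ (ModuleCat.ofHom (h.topMul a))).comp h.theta (zero_add 2) =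
      h.theta.comp (Ext.mk₀ (ModuleCat.ofHom (h.topMul (a + (s + 2 : ℕ))))) (add_zero 2) := by
  rw [theta, ← Ext.comp_assoc _ _ _ (zero_add 1) rfl rfl, topMul_comp_extTopRad,
    Ext.comp_assoc _ _ _ (add_zero 1) (zero_add 1) rfl, radMul_comp_extRadTop,
    Ext.comp_assoc _ _ _ rfl (add_zero 1) rfl]

theorem topMul_comp_beta (a : V) :
    (Ext.mk₀ (ModuleCat.ofHom (h.topMul a))).comp h.beta (zero_add 1) =
      h.beta.comp (Ext.mk₀ (ModuleCat.ofHom (h.topMul (a + 1)))) (add_zero 1) := by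
  rw [beta, ← Ext.comp_assoc _ _ _ (zero_add 1) (add_zero 1) rfl, topMul_comp_extTopRad,
    Ext.comp_assoc _ _ _ (add_zero 1) (zero_add 0) rfl, Ext.mk₀_comp_mk₀,
    Ext.comp_assoc _ _ _ (add_zero 1) (zero_add 0) rfl, Ext.mk₀_comp_mk₀,
    ← ModuleCat.ofHom_comp, ← ModuleCat.ofHom_comp, radMul_radToTop]

theorem beta_comp_extTopRad : h.beta.comp (extTopRad α) rfl =
    h.theta.comp (Ext.mk₀ (ModuleCat.ofHom h.topToRad)) (add_zero 2) := by
  rw [beta, theta, Ext.comp_assoc _ _ _ (add_zero 1) (zero_add 1) rfl, radToTop_comp_extTopRad,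
    Ext.comp_assoc _ _ _ rfl (add_zero 1) rfl]

theorem beta_comp_theta : h.beta.comp h.theta rfl = h.theta.comp h.beta rfl := by
  conv_lhs => rw [theta]
  rw [← Ext.comp_assoc _ _ _ rfl rfl rfl, beta_comp_extTopRad,
    Ext.comp_assoc _ _ _ (add_zero 2) (zero_add 1) rfl, topToRad_comp_extRadTop, beta]

/-- Moving the inner projection `Λα → T` past the next extension class turns it into the socle
inclusion `T → Λα`, leaving `θ` followed by right multiplication by `α^s`. -/
theorem beta_comp_beta : h.beta.comp h.beta rfl =
    h.theta.comp (Ext.mk₀ (ModuleCat.ofHom (h.radToTop ∘ₗ h.topToRad))) (add_zero 2) := by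
  conv_lhs => enter [2]; rw [beta]
  rw [← Ext.comp_assoc _ _ _ rfl (add_zero 1) rfl, beta_comp_extTopRad,
    Ext.comp_assoc _ _ _ (add_zero 2) (zero_add 0) rfl, Ext.mk₀_comp_mk₀, ModuleCat.ofHom_comp]

theorem beta_comp_beta_of_ne (hs : s ≠ 0) : h.beta.comp h.beta rfl = 0 := by
  have h0 : ModuleCat.ofHom (0 : TopModule α →ₗ[Λ] TopModule α) = 0 := rfl
  rw [beta_comp_beta, h.radToTop_topToRad_of_ne hs, h0, Ext.mk₀_zero, Ext.comp_zero]

theorem beta_comp_beta_of_eq (hs : s = 0) : h.beta.comp h.beta rfl = h.theta := by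
  rw [beta_comp_beta, h.radToTop_topToRad_of_eq hs]
  exact Ext.comp_mk₀_id _

/-- Endomorphisms of the top are given by right multiplications. -/
theorem exists_topMul_comp (f : TopModule α →ₗ[Λ] TopModule α) (a b : V) :
    ∃ c : k, (∀ x, h.topMul a (f (h.topMul b x)) = (algebraMap k Λ c) • h.topMul a x) ∧
      (a ≠ b → c = 0) := by
  -- `f` is right multiplication by a lift `z` of its value at 1, and `z e_a` is a scalar multiple
  -- of `e_a` modulo `Λα`.
  obtain ⟨z, hz⟩ := TopModule.mk_surjective α (f (TopModule.mk α 1))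
  obtain ⟨c, y, hc⟩ := h.exists_mul_e z a
  have hf : ∀ x, h.topMul a (f (h.topMul b (TopModule.mk α x))) =
      TopModule.mk α (x * e b * (z * e a)) := by
    intro x
    have : TopModule.mk α (x * e b) = (x * e b) • TopModule.mk α 1 := by
      rw [← map_smul, smul_eq_mul, mul_one]
    rw [topMul_mk, this, map_smul, ← hz, map_smul, topMul_mk, ← map_smul, smul_eq_mul]
  have hf' : ∀ x, h.topMul a (f (h.topMul b (TopModule.mk α x))) =
      TopModule.mk α (c • (x * (e b * e a))) := by
    intro x
    rw [hf, hc, mul_add, map_add, ← mul_assoc (x * e b) y, TopModule.mk_eq_zero.2 ⟨_, rfl⟩, add_zero,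
      mul_smul_comm, mul_assoc]
  by_cases hab : a = b
  · subst hab
    refine ⟨c, fun x => ?_, fun h => absurd rfl h⟩
    obtain ⟨x, rfl⟩ := TopModule.mk_surjective α x
    rw [hf', h.e_mul_self, topMul_mk, ← map_smul, Algebra.smul_def, smul_eq_mul]
  · refine ⟨0, fun x => ?_, fun _ => rfl⟩
    obtain ⟨x, rfl⟩ := TopModule.mk_surjective α x
    rw [hf', h.e_mul_of_ne (Ne.symm hab), mul_zero, smul_zero, map_zero, map_zero, zero_smul]

end CyclicPresentation

/-! ### Algebras with monomial bases -/

section MonomialBases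

variable {k : Type*} [Field k] {B : Type*} [Semiring B] [Algebra k B]

theorem exists_polynomial_algEquiv {x : B} (hli : LinearIndependent k fun m : ℕ => x ^ m)
    (hsp : ⊤ ≤ Submodule.span k (Set.range fun m : ℕ => x ^ m)) :
    ∃ e : Polynomial k ≃ₐ[k] B, e Polynomial.X = x := by
  -- `B` is only given as a semiring; negation is multiplication by the scalar `-1`.
  let _ : Ring B := Algebra.semiringToRing k
  let L : Polynomial k ≃ₗ[k] B := (Polynomial.basisMonomials k).equiv (Module.Basis.mk hli hsp) (Equiv.refl ℕ)
  have hL : L.toLinearMap = (Polynomial.aeval x).toLinearMap :=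
    (Polynomial.basisMonomials k).ext fun m => by
      change L (Polynomial.basisMonomials k m) = Polynomial.aeval x (Polynomial.basisMonomials k m)
      rw [Module.Basis.equiv_apply, Module.Basis.mk_apply]
      simp
  have hb : Function.Bijective (Polynomial.aeval (R := k) x) := by
    have : ⇑(Polynomial.aeval (R := k) x) = ⇑L := by
      funext p
      exact (LinearMap.congr_fun hL p).symm
    rw [this]
    exact L.bijective
  exact ⟨AlgEquiv.ofBijective _ hb, Polynomial.aeval_X x⟩

theorem MvPolynomial.exists_mk_eq_aeval_add (z : MvPolynomial (Fin 2) k) :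
    ∃ p q : Polynomial k,
      Ideal.Quotient.mk (Ideal.span {(X 1 : MvPolynomial (Fin 2) k) ^ 2}) z =
        Ideal.Quotient.mk _ (Polynomial.aeval (X 0) p + Polynomial.aeval (X 0) q * X 1) := by
  induction z using MvPolynomial.induction_on with
  | C c => exact ⟨.C c, 0, by simp [MvPolynomial.algebraMap_eq]⟩
  | add z w hz hw =>
    obtain ⟨p, q, hz⟩ := hz
    obtain ⟨p', q', hw⟩ := hw
    exact ⟨p + p', q + q', by rw [map_add, hz, hw, ← map_add]; congr 1; simp only [map_add]; ring⟩
  | mul_X z i hz =>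
    obtain ⟨p, q, hz⟩ := hz
    fin_cases i
    · exact ⟨p * .X, q * .X, by
        simp only [Fin.zero_eta]
        rw [map_mul, hz, ← map_mul]; congr 1; simp only [map_mul, Polynomial.aeval_X]; ring⟩
    · refine ⟨0, p, ?_⟩
      simp only [Fin.mk_one]
      rw [map_mul, hz, ← map_mul, Ideal.Quotient.eq, Ideal.mem_span_singleton]
      exact ⟨Polynomial.aeval (X 0) q, by simp only [map_zero]; ring⟩

/-- Both sides are identified with pairs `(p, q)` of polynomials, standing for `p(x) + q(x) y`;
evaluation at `x, y` respects these normal forms. -/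
theorem exists_mvPolynomial_quotient_algEquiv {x y : B} (hxy : Commute x y) (hy : y * y = 0)
    (hli : LinearIndependent k (Sum.elim (fun m : ℕ => x ^ m) fun m : ℕ => x ^ m * y))
    (hsp : ⊤ ≤ Submodule.span k
      (Set.range (Sum.elim (fun m : ℕ => x ^ m) fun m : ℕ => x ^ m * y))) :
    ∃ e : (MvPolynomial (Fin 2) k ⧸ Ideal.span {(MvPolynomial.X 1 : MvPolynomial (Fin 2) k) ^ 2})
        ≃ₐ[k] B,
      e (Ideal.Quotient.mk _ (MvPolynomial.X 0)) = x ∧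
        e (Ideal.Quotient.mk _ (MvPolynomial.X 1)) = y := by
  let _ : Ring B := Algebra.semiringToRing k
  let L : (Polynomial k × Polynomial k) ≃ₗ[k] B :=
    ((Polynomial.basisMonomials k).prod (Polynomial.basisMonomials k)).equiv
      (Module.Basis.mk hli hsp) (Equiv.refl _)
  have hL : ∀ p q, L (p, q) = Polynomial.aeval x p + Polynomial.aeval x q * y := by
    have : L.toLinearMap = LinearMap.coprod (Polynomial.aeval x).toLinearMap
        (LinearMap.mulRight k y ∘ₗ (Polynomial.aeval x).toLinearMap) := by
      refine ((Polynomial.basisMonomials k).prod (Polynomial.basisMonomials k)).ext ?_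
      rintro (m | m) <;> simp [L, Module.Basis.mk_apply, -Module.Basis.prod_apply] <;> simp
    exact fun p q => LinearMap.congr_fun this (p, q)
  have hcx : ∀ p : Polynomial k, Commute (Polynomial.aeval x p) x := fun p => by
    simpa using (Commute.all p Polynomial.X).map (Polynomial.aeval (R := k) x)
  have hcy : ∀ p : Polynomial k, Commute (Polynomial.aeval x p) y := fun p => by
    induction p using Polynomial.induction_on' with
    | add p q hp hq => rw [map_add]; exact hp.add_left hq
    | monomial m c =>
      rw [Polynomial.aeval_monomial]
      exact (show Commute (algebraMap k B c) y from Algebra.commutes c y).mul_left (hxy.pow_left m)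
  -- Evaluation of multivariate polynomials needs a commutative target, and commutativity follows
  -- since `x` and `y` commute and generate `B`.
  have hc : ∀ z w : B, z * w = w * z := by
    intro z w
    obtain ⟨⟨p, q⟩, rfl⟩ := L.surjective z
    obtain ⟨⟨p', q'⟩, rfl⟩ := L.surjective w
    have hpp : ∀ p q : Polynomial k, Commute (Polynomial.aeval x p) (Polynomial.aeval x q) :=
      fun p q => (Commute.all p q).map (Polynomial.aeval (R := k) x)
    rw [hL, hL]
    change Commute _ _
    exact (((hpp _ _).add_right ((hpp _ _).mul_right (hcy _))).add_left
      (((hpp _ _).mul_left (hcy _).symm).add_right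
        (((hpp _ _).mul_left (hcy _).symm).mul_right ((hcy _).mul_left (Commute.refl y)))))
  let _ : CommRing B := { (inferInstance : Ring B) with mul_comm := hc }
  let f : MvPolynomial (Fin 2) k →ₐ[k] B := MvPolynomial.aeval ![x, y]
  have hf : ∀ z ∈ Ideal.span {(MvPolynomial.X 1 : MvPolynomial (Fin 2) k) ^ 2}, f z = 0 := by
    intro z hz
    obtain ⟨w, rfl⟩ := Ideal.mem_span_singleton.1 hz
    simp [f, pow_two, hy]
  let g := Ideal.Quotient.liftₐ _ f hf
  have hg : ∀ p q : Polynomial k, g (Ideal.Quotient.mk _ (Polynomial.aeval (MvPolynomial.X 0) p +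
      Polynomial.aeval (MvPolynomial.X 0) q * MvPolynomial.X 1)) = L (p, q) := by
    intro p q
    rw [hL]
    change f _ = _
    rw [map_add, map_mul, ← Polynomial.aeval_algHom_apply, ← Polynomial.aeval_algHom_apply]
    simp [f]
  have hb : Function.Bijective g := by
    constructor
    · refine (injective_iff_map_eq_zero g).2 fun z hz => ?_
      obtain ⟨z, rfl⟩ := Ideal.Quotient.mk_surjective z
      obtain ⟨p, q, h⟩ := MvPolynomial.exists_mk_eq_aeval_add z
      rw [h, hg, LinearEquiv.map_eq_zero_iff, Prod.mk_eq_zero] at hz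
      rw [h, hz.1, hz.2]
      simp
    · intro z
      obtain ⟨⟨p, q⟩, rfl⟩ := L.surjective z
      exact ⟨_, hg p q⟩
  refine ⟨AlgEquiv.ofBijective g hb, ?_, ?_⟩
  · change f _ = _
    simp [f]
  · change f _ = _
    simp [f]

end MonomialBases

/-! ### Homogeneous families in a graded direct sum -/

section HomogeneousBases

variable {k : Type*} [Field k] {M : ℕ → Type*} [∀ d, AddCommGroup (M d)] [∀ d, Module k (M d)]
  {ι : Type*}

theorem DirectSum.linearIndependent_of {deg : ι → ℕ} (hdeg : Function.Injective deg)
    {ξ : ∀ j, M (deg j)} (hξ : ∀ j, ξ j ≠ 0) :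
    LinearIndependent k fun j => DirectSum.of M (deg j) (ξ j) := by
  classical
  rw [linearIndependent_iff']
  intro s g hg j hj
  have h := congrArg (DirectSum.component k ℕ M (deg j)) hg
  rw [map_sum, Finset.sum_eq_single j, map_smul, map_zero] at h
  · have h' : g j • ξ j = 0 := (congrArg (g j • ·) (DirectSum.of_eq_same (β := M) (deg j) (ξ j))).symm.trans h
    exact (smul_eq_zero.1 h').resolve_right (hξ j)
  · intro i _ hij
    rw [map_smul]
    have : DirectSum.component k ℕ M (deg j) (DirectSum.of M (deg i) (ξ i)) = 0 :=
      DirectSum.of_eq_of_ne _ _ _ fun h => hij (hdeg h).symm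
    rw [this, smul_zero]
  · exact fun h => absurd hj h

theorem DirectSum.top_le_span {b : ι → DirectSum ℕ M}
    (h : ∀ d (ξ : M d), DirectSum.of M d ξ ∈ Submodule.span k (Set.range b)) :
    ⊤ ≤ Submodule.span k (Set.range b) := by
  intro z _
  induction z using DirectSum.induction_on with
  | zero => exact zero_mem _
  | of d ξ => exact h d ξ
  | add x y hx hy => exact add_mem (hx trivial) (hy trivial)

end HomogeneousBases

/-! ### Ext-algebras of direct summands -/

namespace ExtAlg

open Abelian

variable {C : Type u} [Category.{v} C] [Abelian C] [HasExt.{w} C]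

theorem of_mul_of {X : C} {i j c : ℕ} (α : Ext X X i) (β : Ext X X j) (h : j + i = c) :
    DirectSum.of (fun n => Ext X X n) i α * DirectSum.of (fun n => Ext X X n) j β =
      DirectSum.of (fun n => Ext X X n) c (β.comp α h) :=
  (DirectSum.of_mul_of _ _).trans
    (DirectSum.of_eq_of_gradedMonoid_eq (mk_comp_eq β α (add_comm j i) h))

theorem comp_assoc_of_first_deg_zero {X Y Z W : C} {b c d : ℕ} (α : Ext X Y 0) (β : Ext Y Z b)
    (γ : Ext Z W c) (h : b + c = d) :
    (α.comp β (zero_add b)).comp γ h = α.comp (β.comp γ h) (zero_add d) :=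
  Ext.comp_assoc _ _ _ _ _ (by omega)

theorem one_eq (X : C) :
    (1 : DirectSum ℕ fun n => Ext X X n) = DirectSum.of (fun n => Ext X X n) 0 (Ext.mk₀ (𝟙 X)) := rfl

variable (k : Type*) [Field k] [Linear k C] {S T : C} (i : S ⟶ T) (p : T ⟶ S)

/-- The compression of the Ext-algebra of `T` along maps `i : S ⟶ T` and `p : T ⟶ S`. -/
def compress : (DirectSum ℕ fun n => Ext T T n) →ₗ[k] DirectSum ℕ fun n => Ext S S n :=
  DFinsupp.mapRange.linearMap fun n =>
    { toFun := fun ξ => (Ext.mk₀ i).comp (ξ.comp (Ext.mk₀ p) (add_zero n)) (zero_add n)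
      map_add' := fun ξ η => by rw [Ext.add_comp, Ext.comp_add]
      map_smul' := fun c ξ => by rw [Ext.smul_comp, Ext.comp_smul, RingHom.id_apply] }

theorem compress_of (n : ℕ) (ξ : Ext T T n) :
    compress k i p (DirectSum.of (fun n => Ext T T n) n ξ) = DirectSum.of (fun n => Ext S S n) n
      ((Ext.mk₀ i).comp (ξ.comp (Ext.mk₀ p) (add_zero n)) (zero_add n)) :=
  DFinsupp.mapRange_single (hf := fun _ => map_zero _)

/-- The class of the endomorphism `p ≫ i` of `T`. -/
def compressIdem : DirectSum ℕ fun n => Ext T T n :=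
  DirectSum.of (fun n => Ext T T n) 0 (Ext.mk₀ (p ≫ i))

/-- The inner `p` and `i` of the two factors meet as `p ≫ i`, so compression is multiplicative only
up to an inserted idempotent. -/
theorem compress_mul_compress (z w : DirectSum ℕ fun n => Ext T T n) :
    compress k i p z * compress k i p w = compress k i p (z * compressIdem i p * w) := by
  induction z using DirectSum.induction_on with
  | zero => simp
  | add z z' hz hz' => simp only [map_add, add_mul, hz, hz']
  | of m ξ =>
    induction w using DirectSum.induction_on with
    | zero => simp
    | add w w' hw hw' => simp only [map_add, mul_add, hw, hw']
    | of n η =>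
      rw [compressIdem, of_mul_of _ _ (zero_add m), of_mul_of _ _ rfl, compress_of, compress_of,
        compress_of, of_mul_of _ _ rfl]
      congr 1
      rw [← Ext.mk₀_comp_mk₀]
      simp only [Ext.comp_assoc_of_second_deg_zero, Ext.comp_assoc_of_third_deg_zero,
        comp_assoc_of_first_deg_zero]

variable {i p} (hip : i ≫ p = 𝟙 S)

include hip

theorem compressIdem_mul_self : compressIdem i p * compressIdem i p = compressIdem i p := by
  rw [compressIdem, of_mul_of _ _ (zero_add 0), Ext.mk₀_comp_mk₀]
  simp [reassoc_of% hip]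

theorem compress_one : compress k i p 1 = 1 := by
  rw [one_eq, one_eq, compress_of, Ext.mk₀_comp_mk₀, Ext.mk₀_comp_mk₀, Category.id_comp, hip]

theorem compress_idem_mul (z : DirectSum ℕ fun n => Ext T T n) :
    compress k i p (compressIdem i p * z) = compress k i p z := by
  induction z using DirectSum.induction_on with
  | zero => simp
  | add z z' hz hz' => simp only [map_add, mul_add, hz, hz']
  | of m ξ =>
    rw [compressIdem, of_mul_of _ _ (add_zero m), compress_of, compress_of,
      Ext.comp_assoc_of_third_deg_zero, Ext.mk₀_comp_mk₀, Category.assoc, hip, Category.comp_id]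

theorem compress_mul_idem (z : DirectSum ℕ fun n => Ext T T n) :
    compress k i p (z * compressIdem i p) = compress k i p z := by
  induction z using DirectSum.induction_on with
  | zero => simp
  | add z z' hz hz' => simp only [map_add, add_mul, hz, hz']
  | of m ξ =>
    rw [compressIdem, of_mul_of _ _ (zero_add m), compress_of, compress_of,
      Ext.comp_assoc_of_third_deg_zero, Ext.mk₀_comp_mk₀_assoc, reassoc_of% hip]

/-- An idempotent commuting with `w` can be moved to the outer end of the product, where compression
absorbs it. -/
theorem compress_mul_of_commute (z : DirectSum ℕ fun n => Ext T T n)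
    {w : DirectSum ℕ fun n => Ext T T n} (hw : Commute (compressIdem i p) w) :
    compress k i p (z * w) = compress k i p z * compress k i p w := by
  rw [compress_mul_compress, mul_assoc, hw.eq, ← mul_assoc, compress_mul_idem k hip]

theorem compress_pow_of_commute {w : DirectSum ℕ fun n => Ext T T n}
    (hw : Commute (compressIdem i p) w) (m : ℕ) :
    compress k i p (w ^ m) = compress k i p w ^ m := by
  induction m with
  | zero => rw [pow_zero, pow_zero, compress_one k hip]
  | succ m ih => rw [pow_succ, pow_succ, compress_mul_of_commute k hip _ hw, ih]

theorem exists_compress_eq (n : ℕ) (ξ : Ext S S n) :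
    ∃ η : Ext T T n, compress k i p (DirectSum.of (fun n => Ext T T n) n η) =
      DirectSum.of (fun n => Ext S S n) n ξ := by
  refine ⟨(Ext.mk₀ p).comp (ξ.comp (Ext.mk₀ i) (add_zero n)) (zero_add n), ?_⟩
  rw [compress_of, Ext.comp_assoc_of_third_deg_zero, Ext.mk₀_comp_mk₀_assoc, hip, Ext.mk₀_id_comp,
    Ext.comp_assoc_of_third_deg_zero, Ext.mk₀_comp_mk₀, hip, Ext.comp_mk₀_id]

omit hip in
-- Composing the compression with `p` before and `i` after recovers the corner element, so
-- compression is injective on the corner.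
theorem idem_mul_mul_idem_eq_zero {n : ℕ} {ξ : Ext T T n}
    (h : compress k i p (DirectSum.of (fun n => Ext T T n) n ξ) = 0) :
    compressIdem i p * DirectSum.of (fun n => Ext T T n) n ξ * compressIdem i p = 0 := by
  rw [compress_of] at h
  have h' := DirectSum.of_injective n (h.trans (map_zero _).symm)
  rw [compressIdem, of_mul_of _ _ (add_zero n), of_mul_of _ _ (zero_add n), ← Ext.mk₀_comp_mk₀]
  have : (Ext.mk₀ p).comp (((Ext.mk₀ i).comp (ξ.comp (Ext.mk₀ p) (add_zero n)) (zero_add n)).comp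
      (Ext.mk₀ i) (add_zero n)) (zero_add n) = 0 := by
    rw [h', Ext.zero_comp, Ext.comp_zero]
  rw [← map_zero (DirectSum.of (fun n => Ext T T n) n), ← this]
  congr 1
  simp only [Ext.comp_assoc_of_third_deg_zero,
    Ext.mk₀_comp_mk₀_assoc, Ext.mk₀_comp_mk₀]

end ExtAlg

/-! ### The Ext-algebra of the top and of its simple summands -/

namespace CyclicPresentation

open Abelian ExtAlg

variable {k : Type u} [Field k] {Λ : Type u} [Ring Λ] [Algebra k Λ] {V : Type} [CommRing V]
  [Fintype V] {s : ℕ} {α : Λ} {e : V → Λ} (h : CyclicPresentation k s α e)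

/-- The periodicity class as an element of the Ext-algebra. -/
def Theta : ExtAlgebra Λ (TopModule α) := DirectSum.of _ 2 h.theta

/-- The class of degree one as an element of the Ext-algebra. -/
def Beta : ExtAlgebra Λ (TopModule α) := DirectSum.of _ 1 h.beta

/-- The idempotents of degree zero of the Ext-algebra. -/
def Idem (a : V) : ExtAlgebra Λ (TopModule α) :=
  DirectSum.of _ 0 (Ext.mk₀ (ModuleCat.ofHom (h.topMul a)))

include h

theorem Theta_mul_Idem (a : V) : h.Theta * h.Idem a = h.Idem (a + (s + 2 : ℕ)) * h.Theta := by
  rw [Theta, Idem, Idem, of_mul_of _ _ (zero_add 2), of_mul_of _ _ (add_zero 2), topMul_comp_theta]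

theorem Beta_mul_Idem (a : V) : h.Beta * h.Idem a = h.Idem (a + 1) * h.Beta := by
  rw [Beta, Idem, Idem, of_mul_of _ _ (zero_add 1), of_mul_of _ _ (add_zero 1), topMul_comp_beta]

theorem commute_Beta_Theta : Commute h.Beta h.Theta := by
  change _ * _ = _ * _
  rw [Beta, Theta, of_mul_of _ _ rfl, of_mul_of (c := 3) _ _ rfl, beta_comp_theta]

theorem Beta_mul_Beta_of_ne (hs : s ≠ 0) : h.Beta * h.Beta = 0 := by
  rw [Beta, of_mul_of _ _ rfl, h.beta_comp_beta_of_ne hs, map_zero]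

theorem Beta_mul_Beta_of_eq (hs : s = 0) : h.Beta * h.Beta = h.Theta := by
  rw [Beta, of_mul_of _ _ rfl, h.beta_comp_beta_of_eq hs, Theta]

theorem Theta_pow_mul_Idem (m : ℕ) (a : V) :
    h.Theta ^ m * h.Idem a = h.Idem (a + (m * (s + 2) : ℕ)) * h.Theta ^ m := by
  induction m generalizing a with
  | zero => simp
  | succ m ih =>
    rw [pow_succ, mul_assoc, Theta_mul_Idem, ← mul_assoc, ih, mul_assoc]
    push_cast
    ring_nf

theorem Beta_mul_Theta_pow_mul_Idem (m : ℕ) (a : V) :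
    h.Beta * h.Theta ^ m * h.Idem a =
      h.Idem (a + (m * (s + 2) + 1 : ℕ)) * (h.Beta * h.Theta ^ m) := by
  rw [mul_assoc, Theta_pow_mul_Idem, ← mul_assoc, Beta_mul_Idem, mul_assoc]
  push_cast
  ring_nf

theorem exists_eq_mul_Theta_pow (m : ℕ) (ξ : Ext.{u} (top α) (top α) (2 * m)) :
    ∃ f : Ext.{u} (top α) (top α) 0,
      (DirectSum.of _ (2 * m) ξ : ExtAlgebra Λ (TopModule α)) = DirectSum.of _ 0 f * h.Theta ^ m := by
  induction m with
  | zero => exact ⟨ξ, by rw [pow_zero, mul_one]⟩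
  | succ m ih =>
    obtain ⟨x, rfl⟩ := (h.theta_comp_bijective (2 * m)).2 ξ
    obtain ⟨f, hf⟩ := ih x
    refine ⟨f, ?_⟩
    rw [pow_succ, ← mul_assoc, ← hf, Theta, of_mul_of _ _ (add_comm 2 (2 * m))]
    rfl

theorem exists_eq_mul_Beta_mul_Theta_pow (m : ℕ) (ξ : Ext.{u} (top α) (top α) (2 * m + 1)) :
    ∃ f : Ext.{u} (top α) (top α) 0,
      (DirectSum.of _ (2 * m + 1) ξ : ExtAlgebra Λ (TopModule α)) =
        DirectSum.of _ 0 f * (h.Beta * h.Theta ^ m) := by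
  induction m with
  | zero =>
    obtain ⟨f, rfl⟩ := h.beta_comp_bijective.2 ξ
    refine ⟨f, ?_⟩
    rw [pow_zero, mul_one, Beta, of_mul_of _ _ (add_zero 1)]
  | succ m ih =>
    obtain ⟨x, rfl⟩ := (h.theta_comp_bijective (2 * m + 1)).2 ξ
    obtain ⟨f, hf⟩ := ih x
    refine ⟨f, ?_⟩
    rw [pow_succ, ← mul_assoc h.Beta, ← mul_assoc, ← hf, Theta,
      of_mul_of _ _ (add_comm 2 (2 * m + 1))]
    rfl

theorem eq_zero_of_mul_Theta_pow (m : ℕ) {d : ℕ} {ξ : Ext.{u} (top α) (top α) d}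
    (hξ : (DirectSum.of _ d ξ : ExtAlgebra Λ (TopModule α)) * h.Theta ^ m = 0) : ξ = 0 := by
  induction m generalizing d ξ with
  | zero =>
    rw [pow_zero, mul_one] at hξ
    exact DirectSum.of_injective d (hξ.trans (map_zero _).symm)
  | succ m ih =>
    rw [pow_succ', ← mul_assoc, Theta, of_mul_of _ _ (add_comm 2 d)] at hξ
    exact (h.theta_comp_bijective d).1 ((ih hξ).trans (Ext.comp_zero _ _ _ _ _).symm)

theorem eq_zero_of_mul_Beta_mul_Theta_pow (m : ℕ) {ξ : Ext.{u} (top α) (top α) 0}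
    (hξ : (DirectSum.of _ 0 ξ : ExtAlgebra Λ (TopModule α)) * (h.Beta * h.Theta ^ m) = 0) :
    ξ = 0 := by
  rw [← mul_assoc, Beta, of_mul_of _ _ (add_zero 1)] at hξ
  exact h.beta_comp_bijective.1
    ((h.eq_zero_of_mul_Theta_pow m hξ).trans (Ext.comp_zero _ _ _ _ _).symm)

theorem topMul_ne_zero (a : V) : h.topMul a ≠ 0 := by
  intro h0
  have h1 := LinearMap.congr_fun h0 (TopModule.mk α 1)
  rw [topMul_mk, one_mul, LinearMap.zero_apply, TopModule.mk_eq_zero] at h1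
  obtain ⟨y, hy⟩ := h1
  exact one_ne_zero (h.eq_zero_of_smul_e (c := (1 : k)) ((one_smul k _).trans hy))

theorem mk₀_topMul_ne_zero (a : V) : Ext.mk₀ (ModuleCat.ofHom (h.topMul a)) ≠ 0 := by
  rw [Ne, Ext.mk₀_eq_zero_iff]
  exact fun h0 => h.topMul_ne_zero a (congrArg ModuleCat.Hom.hom h0)

theorem exists_Idem_mul_mul_Idem (f : Ext.{u} (top α) (top α) 0) (a b : V) :
    ∃ c : k, h.Idem a * DirectSum.of _ 0 f * h.Idem b = c • h.Idem a ∧ (a ≠ b → c = 0) := by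
  obtain ⟨f, rfl⟩ := (Ext.mk₀_bijective _ _).2 f
  obtain ⟨c, hc, hab⟩ := h.exists_topMul_comp f.hom a b
  refine ⟨c, ?_, hab⟩
  have h2 : c • h.Idem a = DirectSum.of _ 0 (c • Ext.mk₀ (ModuleCat.ofHom (h.topMul a))) :=
    ((DirectSum.lof k ℕ _ 0).map_smul c _).symm
  rw [h2, ← Ext.mk₀_smul, Idem, Idem, of_mul_of _ _ (zero_add 0), of_mul_of _ _ (zero_add 0),
    Ext.mk₀_comp_mk₀, Ext.mk₀_comp_mk₀]
  exact congrArg _ (congrArg _ (ModuleCat.hom_ext (LinearMap.ext fun x => hc x)))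

theorem exists_Theta_pow_eq (m : ℕ) : ∃ ξ, h.Theta ^ m = DirectSum.of _ (2 * m) ξ := by
  induction m with
  | zero => exact ⟨Ext.mk₀ (𝟙 _), rfl⟩
  | succ m ih =>
    obtain ⟨ξ, hξ⟩ := ih
    exact ⟨_, by rw [pow_succ, hξ, Theta, of_mul_of _ _ (add_comm 2 (2 * m))]; rfl⟩

theorem exists_Beta_mul_Theta_pow_eq (m : ℕ) :
    ∃ ξ, h.Beta * h.Theta ^ m = DirectSum.of _ (2 * m + 1) ξ := by
  obtain ⟨ξ, hξ⟩ := h.exists_Theta_pow_eq m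
  exact ⟨_, by rw [hξ, Beta, of_mul_of _ _ rfl]⟩

/-! ### The graded pieces of the Ext-algebra of a summand -/

section Summand

variable {S : Type u} [AddCommGroup S] [Module Λ S] {i : ModuleCat.of Λ S ⟶ top α}
  {p : top α ⟶ ModuleCat.of Λ S} {a : V} (hip : i ≫ p = 𝟙 _)
  (hpi : p ≫ i = ModuleCat.ofHom (h.topMul a))

include hpi in
theorem compressIdem_eq : compressIdem i p = h.Idem a := by rw [compressIdem, hpi, Idem]

include hip hpi

/-- Compression does not see outer factors `e_a`, and `e_a f w e_a = (e_a f e_b) w` with `e_a f e_b`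
a multiple of `e_a` that vanishes unless `a = b`. -/
theorem exists_eq_smul_compress_of {w : ExtAlgebra Λ (TopModule α)} {b : V}
    (hw : w * h.Idem a = h.Idem b * w) {d : ℕ}
    (hd : ∀ η : Ext.{u} (top α) (top α) d, ∃ f : Ext.{u} (top α) (top α) 0,
      (DirectSum.of _ d η : ExtAlgebra Λ (TopModule α)) = DirectSum.of _ 0 f * w)
    (ξ : Ext.{u} (ModuleCat.of Λ S) (ModuleCat.of Λ S) d) :
    ∃ c : k, DirectSum.of _ d ξ = c • compress k i p w ∧ (a ≠ b → c = 0) := by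
  obtain ⟨η, hη⟩ := exists_compress_eq k hip d ξ
  obtain ⟨f, hf⟩ := hd η
  obtain ⟨c, hc, hab⟩ := h.exists_Idem_mul_mul_Idem f a b
  refine ⟨c, ?_, hab⟩
  rw [← hη, hf, ← compress_idem_mul k hip, ← compress_mul_idem k hip, h.compressIdem_eq hpi,
    mul_assoc, mul_assoc, hw, ← mul_assoc (DirectSum.of _ 0 f), ← mul_assoc, ← mul_assoc, hc,
    smul_mul_assoc, map_smul, ← h.compressIdem_eq hpi, compress_idem_mul k hip]

theorem exists_eq_smul_compress_Theta_pow (m : ℕ)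
    (ξ : Ext.{u} (ModuleCat.of Λ S) (ModuleCat.of Λ S) (2 * m)) :
    ∃ c : k, DirectSum.of _ (2 * m) ξ = c • compress k i p (h.Theta ^ m) ∧
      (((m * (s + 2) : ℕ) : V) ≠ 0 → c = 0) := by
  obtain ⟨c, hc, hab⟩ := h.exists_eq_smul_compress_of hip hpi (h.Theta_pow_mul_Idem m a)
    (h.exists_eq_mul_Theta_pow m) ξ
  exact ⟨c, hc, fun h0 => hab fun h1 => h0 (left_eq_add.1 h1)⟩

theorem exists_eq_smul_compress_Beta_mul_Theta_pow (m : ℕ)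
    (ξ : Ext.{u} (ModuleCat.of Λ S) (ModuleCat.of Λ S) (2 * m + 1)) :
    ∃ c : k, DirectSum.of _ (2 * m + 1) ξ = c • compress k i p (h.Beta * h.Theta ^ m) ∧
      (((m * (s + 2) + 1 : ℕ) : V) ≠ 0 → c = 0) := by
  obtain ⟨c, hc, hab⟩ := h.exists_eq_smul_compress_of hip hpi (h.Beta_mul_Theta_pow_mul_Idem m a)
    (h.exists_eq_mul_Beta_mul_Theta_pow m) ξ
  exact ⟨c, hc, fun h0 => hab fun h1 => h0 (left_eq_add.1 h1)⟩

omit hip in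
theorem commute_Theta_pow {m : ℕ} (hm : ((m * (s + 2) : ℕ) : V) = 0) :
    Commute (compressIdem i p) (h.Theta ^ m) := by
  rw [h.compressIdem_eq hpi]
  exact ((h.Theta_pow_mul_Idem m a).trans (by rw [hm, add_zero])).symm

omit hip in
theorem commute_Beta_mul_Theta_pow {m : ℕ} (hm : ((m * (s + 2) + 1 : ℕ) : V) = 0) :
    Commute (compressIdem i p) (h.Beta * h.Theta ^ m) := by
  rw [h.compressIdem_eq hpi]
  exact ((h.Beta_mul_Theta_pow_mul_Idem m a).trans (by rw [hm, add_zero])).symm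

/-- If the compression vanished, so would the corner element `e_a w e_a`, which equals `e_a w`
because `w` commutes with the idempotent. -/
theorem exists_compress_eq_of {w : ExtAlgebra Λ (TopModule α)}
    (hw : Commute (compressIdem i p) w) {d : ℕ} (hd : ∃ ξ, w = DirectSum.of _ d ξ)
    (h0 : h.Idem a * w ≠ 0) :
    ∃ ξ, ξ ≠ 0 ∧ compress k i p w = DirectSum.of _ d ξ := by
  obtain ⟨ξ, rfl⟩ := hd
  refine ⟨_, ?_, compress_of k i p d ξ⟩
  intro h1
  have h2 := idem_mul_mul_idem_eq_zero k ((compress_of k i p d ξ).trans (by rw [h1, map_zero]))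
  rw [mul_assoc, ← hw.eq, ← mul_assoc, compressIdem_mul_self hip, h.compressIdem_eq hpi] at h2
  exact h0 h2

theorem exists_compress_Theta_pow_eq {m : ℕ} (hm : ((m * (s + 2) : ℕ) : V) = 0) :
    ∃ ξ, ξ ≠ 0 ∧ compress k i p (h.Theta ^ m) = DirectSum.of _ (2 * m) ξ :=
  h.exists_compress_eq_of hip hpi (h.commute_Theta_pow hpi hm) (h.exists_Theta_pow_eq m)
    fun h0 => h.mk₀_topMul_ne_zero a (h.eq_zero_of_mul_Theta_pow m h0)

theorem exists_compress_Beta_mul_Theta_pow_eq {m : ℕ} (hm : ((m * (s + 2) + 1 : ℕ) : V) = 0) :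
    ∃ ξ, ξ ≠ 0 ∧ compress k i p (h.Beta * h.Theta ^ m) = DirectSum.of _ (2 * m + 1) ξ :=
  h.exists_compress_eq_of hip hpi (h.commute_Beta_mul_Theta_pow hpi hm)
    (h.exists_Beta_mul_Theta_pow_eq m)
    fun h0 => h.mk₀_topMul_ne_zero a (h.eq_zero_of_mul_Beta_mul_Theta_pow m h0)

end Summand

/-- Every simple module is a direct summand of the top. -/
theorem exists_summand (S : Type u) [AddCommGroup S] [Module Λ S] [IsSimpleModule Λ S] :
    ∃ (a : V) (i : ModuleCat.of Λ S ⟶ top α) (p : top α ⟶ ModuleCat.of Λ S),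
      i ≫ p = 𝟙 _ ∧ p ≫ i = ModuleCat.ofHom (h.topMul a) := by
  have : Nontrivial S := IsSimpleModule.nontrivial Λ S
  -- Normality of `α` makes its annihilator in `S` a submodule. It is nonzero because `α` is
  -- nilpotent, hence everything by simplicity.
  let K : Submodule Λ S :=
    { carrier := {m | α • m = 0}
      zero_mem' := smul_zero _
      add_mem' := fun {x y} hx hy => by
        change α • (x + y) = 0
        rw [smul_add, show α • x = 0 from hx, show α • y = 0 from hy, add_zero]
      smul_mem' := fun c x hx => by
        obtain ⟨y, hy⟩ := h.exists_mul c
        change α • c • x = 0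
        rw [← mul_smul, hy, mul_smul, show α • x = 0 from hx, smul_zero] }
  have hK : K = ⊤ := by
    refine (eq_bot_or_eq_top K).resolve_left fun hK => ?_
    obtain ⟨x, hx⟩ := exists_ne (0 : S)
    have hj : ∀ j, α ^ j • x ≠ 0 := by
      intro j
      induction j with
      | zero => rwa [pow_zero, one_smul]
      | succ j ih =>
        intro h0
        rw [pow_succ', mul_smul] at h0
        exact ih ((Submodule.mem_bot Λ).1 (hK ▸ (show α ^ j • x ∈ K from h0)))
    exact hj (s + 2) (by rw [h.pow_eq_zero, zero_smul])
  have hα : ∀ x : S, α • x = 0 := fun x => (hK ▸ Submodule.mem_top : x ∈ K)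
  obtain ⟨x, hx⟩ := exists_ne (0 : S)
  obtain ⟨a, ha⟩ : ∃ a, e a • x ≠ 0 := by
    by_contra! h0
    apply hx
    rw [← one_smul Λ x, ← h.sum_e, Finset.sum_smul]
    exact Finset.sum_eq_zero fun a _ => h0 a
  let p : TopModule α →ₗ[Λ] S := TopModule.lift (e a • x) (hα _)
  have hp : Function.Surjective p := by
    refine (LinearMap.surjective_or_eq_zero p).resolve_right fun h0 => ha ?_
    have := LinearMap.congr_fun h0 (TopModule.mk α 1)
    rwa [TopModule.lift_mk, one_smul] at this
  have hpe : p ∘ₗ h.topMul a = p := TopModule.hom_ext fun y => by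
    rw [LinearMap.comp_apply, topMul_mk, TopModule.lift_mk, TopModule.lift_mk, mul_smul, ← mul_smul (e a),
      h.e_mul_self]
  -- This lets right multiplication by `e a` factor through `p`, and the factor `i` is the required
  -- section.
  have hker : p.ker ≤ (h.topMul a).ker := by
    intro y hy
    obtain ⟨y, rfl⟩ := TopModule.mk_surjective α y
    obtain ⟨c, z, hc⟩ := h.exists_mul_e y a
    rw [LinearMap.mem_ker, TopModule.lift_mk, ← mul_smul, hc, add_smul, mul_smul, hα, smul_zero,
      add_zero, Algebra.smul_def, mul_smul] at hy
    have hc0 : c = 0 := by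
      by_contra h0
      apply ha
      rw [← one_smul Λ (e a • x), ← map_one (algebraMap k Λ), ← inv_mul_cancel₀ h0, map_mul,
        mul_smul, hy, smul_zero]
    rw [LinearMap.mem_ker, topMul_mk, hc, hc0, zero_smul, zero_add, TopModule.mk_eq_zero]
    exact ⟨z, rfl⟩
  let i : S →ₗ[Λ] TopModule α :=
    (p.ker.liftQ (h.topMul a) hker).comp (p.quotKerEquivOfSurjective hp).symm.toLinearMap
  have hi : i ∘ₗ p = h.topMul a := LinearMap.ext fun y => by
    change p.ker.liftQ (h.topMul a) hker ((p.quotKerEquivOfSurjective hp).symm (p y)) = _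
    rw [LinearMap.quotKerEquivOfSurjective_symm_apply]
    rfl
  refine ⟨a, ModuleCat.ofHom i, ModuleCat.ofHom p, ModuleCat.hom_ext (LinearMap.ext fun y => ?_),
    ModuleCat.hom_ext hi⟩
  obtain ⟨y, rfl⟩ := hp y
  change p ((i ∘ₗ p) y) = p y
  rw [hi]
  exact LinearMap.congr_fun hpe y

end CyclicPresentation

/-! ### The three isomorphisms -/

namespace CyclicPresentation

open Abelian ExtAlg

variable {k : Type u} [Field k] {Λ : Type u} [Ring Λ] [Algebra k Λ] {V : Type} [CommRing V]
  [Fintype V] {s : ℕ} {α : Λ} {e : V → Λ} (h : CyclicPresentation k s α e)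

include h

theorem exists_algEquiv_of_forall_ne (S : Type u) [AddCommGroup S] [Module Λ S]
    [IsSimpleModule Λ S] {l₁ : ℕ} (hpos : 0 < l₁)
    (hl₁ : ∀ m : ℕ, ((m * (s + 2) : ℕ) : V) = 0 ↔ l₁ ∣ m)
    (hl₂ : ∀ m : ℕ, ((m * (s + 2) + 1 : ℕ) : V) ≠ 0) :
    ∃ f : Polynomial k ≃ₐ[k] ExtAlgebra Λ S, (f Polynomial.X).HasDegree (2 * l₁) := by
  obtain ⟨a, i, p, hip, hpi⟩ := h.exists_summand S
  have hx : ∀ m, compress k i p (h.Theta ^ l₁) ^ m = compress k i p (h.Theta ^ (l₁ * m)) := fun m => by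
    rw [pow_mul, compress_pow_of_commute k hip (h.commute_Theta_pow hpi ((hl₁ l₁).2 dvd_rfl))]
  have hξ : ∀ m, ∃ ξ, ξ ≠ 0 ∧
      compress k i p (h.Theta ^ (l₁ * m)) = DirectSum.of _ (2 * (l₁ * m)) ξ := fun m =>
    h.exists_compress_Theta_pow_eq hip hpi ((hl₁ _).2 (dvd_mul_right _ _))
  choose ξ hξ0 hξ using hξ
  obtain ⟨f, hf⟩ := exists_polynomial_algEquiv (k := k) (x := compress k i p (h.Theta ^ l₁))
    (by
      simp only [hx, hξ]
      exact DirectSum.linearIndependent_of (deg := fun m => 2 * (l₁ * m))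
        (fun m m' hm => Nat.eq_of_mul_eq_mul_left hpos (Nat.eq_of_mul_eq_mul_left two_pos hm)) hξ0)
    (by
      refine DirectSum.top_le_span fun d η => ?_
      obtain ⟨m, rfl | rfl⟩ := Nat.even_or_odd' d
      · obtain ⟨c, hc, h0⟩ := h.exists_eq_smul_compress_Theta_pow hip hpi m η
        rw [hc]
        by_cases hm : l₁ ∣ m
        · obtain ⟨j, rfl⟩ := hm
          rw [← hx]
          exact Submodule.smul_mem _ _ (Submodule.subset_span ⟨j, rfl⟩)
        · rw [h0 (mt (hl₁ m).1 hm), zero_smul]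
          exact zero_mem _
      · obtain ⟨c, hc, h0⟩ := h.exists_eq_smul_compress_Beta_mul_Theta_pow hip hpi m η
        rw [hc, h0 (hl₂ m), zero_smul]
        exact zero_mem _)
  obtain ⟨η, -, hη⟩ := h.exists_compress_Theta_pow_eq hip hpi ((hl₁ l₁).2 dvd_rfl)
  exact ⟨f, η, hf.trans hη⟩

theorem exists_algEquiv_of_ne (S : Type u) [AddCommGroup S] [Module Λ S] [IsSimpleModule Λ S]
    (hs : s ≠ 0) {l₁ l₂ : ℕ} (hpos : 0 < l₁)
    (hl₁ : ∀ m : ℕ, ((m * (s + 2) : ℕ) : V) = 0 ↔ l₁ ∣ m)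
    (hl₂ : IsLeast {m : ℕ | ((m * (s + 2) + 1 : ℕ) : V) = 0} l₂) :
    ∃ f : (MvPolynomial (Fin 2) k ⧸ Ideal.span {(MvPolynomial.X 1 : MvPolynomial (Fin 2) k) ^ 2})
        ≃ₐ[k] ExtAlgebra Λ S,
      (f (Ideal.Quotient.mk _ (MvPolynomial.X 0))).HasDegree (2 * l₁) ∧
        (f (Ideal.Quotient.mk _ (MvPolynomial.X 1))).HasDegree (2 * l₂ + 1) := by
  obtain ⟨a, i, p, hip, hpi⟩ := h.exists_summand S
  have hodd : ∀ j, ((((l₁ * j + l₂) * (s + 2) + 1 : ℕ)) : V) = 0 := fun j => by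
    rw [add_mul, add_assoc, Nat.cast_add, (hl₁ _).2 (dvd_mul_right _ _), zero_add]
    exact hl₂.1
  -- Subtracting the least solution leaves a solution of the homogeneous congruence, that is, a
  -- multiple of `l₁`.
  have hdvd : ∀ m : ℕ, ((m * (s + 2) + 1 : ℕ) : V) = 0 → ∃ j, m = l₁ * j + l₂ := fun m hm => by
    obtain ⟨d, rfl⟩ := Nat.exists_eq_add_of_le (hl₂.2 hm)
    rw [add_comm l₂, add_mul, add_assoc, Nat.cast_add, show _ = (0 : V) from hl₂.1, add_zero,
      hl₁] at hm
    obtain ⟨j, rfl⟩ := hm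
    exact ⟨j, add_comm _ _⟩
  have cx := h.commute_Theta_pow hpi ((hl₁ l₁).2 dvd_rfl)
  have cy := h.commute_Beta_mul_Theta_pow hpi (show _ = (0 : V) from hl₂.1)
  have hx : ∀ m, compress k i p (h.Theta ^ l₁) ^ m = compress k i p (h.Theta ^ (l₁ * m)) := fun m => by
    rw [pow_mul, compress_pow_of_commute k hip cx]
  have hxy : ∀ m, compress k i p (h.Theta ^ l₁) ^ m * compress k i p (h.Beta * h.Theta ^ l₂) =
      compress k i p (h.Beta * h.Theta ^ (l₁ * m + l₂)) := fun m => by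
    rw [hx, ← compress_mul_of_commute k hip _ cy, ← mul_assoc,
      (h.commute_Beta_Theta.symm.pow_left _).eq, mul_assoc, ← pow_add]
  have hξ : ∀ m, ∃ ξ, ξ ≠ 0 ∧
      compress k i p (h.Theta ^ (l₁ * m)) = DirectSum.of _ (2 * (l₁ * m)) ξ := fun m =>
    h.exists_compress_Theta_pow_eq hip hpi ((hl₁ _).2 (dvd_mul_right _ _))
  have hη : ∀ m, ∃ ξ, ξ ≠ 0 ∧ compress k i p (h.Beta * h.Theta ^ (l₁ * m + l₂)) =
      DirectSum.of _ (2 * (l₁ * m + l₂) + 1) ξ := fun m =>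
    h.exists_compress_Beta_mul_Theta_pow_eq hip hpi (hodd m)
  choose ξ hξ0 hξ using hξ
  choose η hη0 hη using hη
  obtain ⟨f, hfx, hfy⟩ := exists_mvPolynomial_quotient_algEquiv (k := k)
    (x := compress k i p (h.Theta ^ l₁)) (y := compress k i p (h.Beta * h.Theta ^ l₂))
    (by
      have h1 := hxy 1
      rw [pow_one, mul_one] at h1
      change _ * _ = _ * _
      rw [h1, ← compress_mul_of_commute k hip _ cx, mul_assoc, ← pow_add, add_comm])
    (by
      rw [← compress_mul_of_commute k hip _ cy, mul_assoc, ← mul_assoc _ h.Beta,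
        (h.commute_Beta_Theta.symm.pow_left _).eq, mul_assoc, ← mul_assoc, h.Beta_mul_Beta_of_ne hs,
        zero_mul, map_zero])
    (by
      let deg : ℕ ⊕ ℕ → ℕ := Sum.elim (fun m => 2 * (l₁ * m)) fun m => 2 * (l₁ * m + l₂) + 1
      let ζ : ∀ j, Ext.{u} (ModuleCat.of Λ S) (ModuleCat.of Λ S) (deg j) := Sum.rec ξ η
      have hζ : Sum.elim (fun m => compress k i p (h.Theta ^ l₁) ^ m)
          (fun m => compress k i p (h.Theta ^ l₁) ^ m * compress k i p (h.Beta * h.Theta ^ l₂)) =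
          fun j => DirectSum.of _ (deg j) (ζ j) := by
        funext j
        obtain m | m := j
        exacts [(hx m).trans (hξ m), (hxy m).trans (hη m)]
      rw [hζ]
      refine DirectSum.linearIndependent_of ?_ (by rintro (m | m); exacts [hξ0 m, hη0 m])
      rintro (m | m) (m' | m') hm <;> simp only [deg, Sum.elim_inl, Sum.elim_inr] at hm
      · exact congrArg _ (Nat.eq_of_mul_eq_mul_left hpos (Nat.eq_of_mul_eq_mul_left two_pos hm))
      · omega
      · omega
      · exact congrArg _ (Nat.eq_of_mul_eq_mul_left hpos (by omega)))
    (by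
      refine DirectSum.top_le_span fun d η => ?_
      obtain ⟨m, rfl | rfl⟩ := Nat.even_or_odd' d
      · obtain ⟨c, hc, h0⟩ := h.exists_eq_smul_compress_Theta_pow hip hpi m η
        rw [hc]
        by_cases hm : l₁ ∣ m
        · obtain ⟨j, rfl⟩ := hm
          rw [← hx]
          exact Submodule.smul_mem _ _ (Submodule.subset_span ⟨.inl j, rfl⟩)
        · rw [h0 (mt (hl₁ m).1 hm), zero_smul]
          exact zero_mem _
      · obtain ⟨c, hc, h0⟩ := h.exists_eq_smul_compress_Beta_mul_Theta_pow hip hpi m η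
        rw [hc]
        by_cases hm : ((m * (s + 2) + 1 : ℕ) : V) = 0
        · obtain ⟨j, rfl⟩ := hdvd m hm
          rw [← hxy]
          exact Submodule.smul_mem _ _ (Submodule.subset_span ⟨.inr j, rfl⟩)
        · rw [h0 hm, zero_smul]
          exact zero_mem _)
  obtain ⟨ζ, -, hζ⟩ := h.exists_compress_Theta_pow_eq hip hpi ((hl₁ l₁).2 dvd_rfl)
  obtain ⟨ζ', -, hζ'⟩ := h.exists_compress_Beta_mul_Theta_pow_eq hip hpi
    (show _ = (0 : V) from hl₂.1)
  exact ⟨f, ⟨ζ, hfx.trans hζ⟩, ζ', hfy.trans hζ'⟩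

/-- With `θ = β²`, degree `d` is spanned by the compression of `β^d`, which is nonzero exactly when
`d = 0` in `V`. All is generated in the least positive such degree. -/
theorem exists_algEquiv_of_eq (S : Type u) [AddCommGroup S] [Module Λ S] [IsSimpleModule Λ S]
    (hs : s = 0) {l : ℕ} (hl : ∀ d : ℕ, (d : V) = 0 ↔ 2 * l + 1 ∣ d) :
    ∃ f : Polynomial k ≃ₐ[k] ExtAlgebra Λ S, (f Polynomial.X).HasDegree (2 * l + 1) := by
  obtain ⟨a, i, p, hip, hpi⟩ := h.exists_summand S
  have hev : ∀ m, h.Theta ^ m = h.Beta ^ (2 * m) := fun m => by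
    rw [← h.Beta_mul_Beta_of_eq hs, pow_mul, pow_two]
  have hod : ∀ m, h.Beta * h.Theta ^ m = h.Beta ^ (2 * m + 1) := fun m => by
    rw [hev, pow_succ']
  have hte : ∀ m, m * (s + 2) = 2 * m := fun m => by rw [hs]; omega
  have hspan : ∀ d (η : Ext.{u} (ModuleCat.of Λ S) (ModuleCat.of Λ S) d), ∃ c : k,
      DirectSum.of _ d η = c • compress k i p (h.Beta ^ d) ∧ ((d : V) ≠ 0 → c = 0) := by
    intro d η
    obtain ⟨m, rfl | rfl⟩ := Nat.even_or_odd' d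
    · have := h.exists_eq_smul_compress_Theta_pow hip hpi m η
      rwa [hev, hte] at this
    · have := h.exists_eq_smul_compress_Beta_mul_Theta_pow hip hpi m η
      rwa [hod, hte] at this
  have hne : ∀ d : ℕ, (d : V) = 0 → ∃ ξ, ξ ≠ 0 ∧
      compress k i p (h.Beta ^ d) = DirectSum.of _ d ξ := by
    intro d hd
    obtain ⟨m, rfl | rfl⟩ := Nat.even_or_odd' d
    · rw [← hev]
      exact h.exists_compress_Theta_pow_eq hip hpi (by rwa [hte])
    · rw [← hod]
      exact h.exists_compress_Beta_mul_Theta_pow_eq hip hpi (by rwa [hte])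
  have hy : ∀ m, compress k i p (h.Beta ^ (2 * l + 1)) ^ m =
      compress k i p (h.Beta ^ ((2 * l + 1) * m)) := fun m => by
    have hc := h.commute_Beta_mul_Theta_pow (m := l) hpi (by rw [hte, hl])
    rw [hod] at hc
    rw [pow_mul, compress_pow_of_commute k hip hc]
  have hξ := fun m : ℕ => hne ((2 * l + 1) * m) ((hl _).2 (dvd_mul_right _ _))
  choose ξ hξ0 hξ using hξ
  obtain ⟨f, hf⟩ := exists_polynomial_algEquiv (k := k)
    (x := compress k i p (h.Beta ^ (2 * l + 1)))
    (by
      simp only [hy, hξ]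
      exact DirectSum.linearIndependent_of (deg := fun m => (2 * l + 1) * m)
        (fun m m' hm => Nat.eq_of_mul_eq_mul_left (Nat.succ_pos _) hm) hξ0)
    (by
      refine DirectSum.top_le_span fun d η => ?_
      obtain ⟨c, hc, h0⟩ := hspan d η
      rw [hc]
      by_cases hd : 2 * l + 1 ∣ d
      · obtain ⟨j, rfl⟩ := hd
        rw [← hy]
        exact Submodule.smul_mem _ _ (Submodule.subset_span ⟨j, rfl⟩)
      · rw [h0 (mt (hl d).1 hd), zero_smul]
        exact zero_mem _)
  obtain ⟨η, -, hη⟩ := hne (2 * l + 1) ((hl _).2 dvd_rfl)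
  exact ⟨f, η, hf.trans hη⟩

end CyclicPresentation

/-! ### Arithmetic of `l₁` and `l₂`, and the main theorem -/

theorem ATilde.natCast_eq_zero_iff (m j : ℕ) : (j : ATilde m) = 0 ↔ m + 1 ∣ j :=
  ZMod.natCast_eq_zero_iff j (m + 1)

end

theorem mainTheorem9 {k : Type u} [Field k] (n t q r : ℕ) (hn : 1 < n) (ht : 2 ≤ t)
    (htqr : t = q * n + r) (hr : r < n)
    (S : Type u) [AddCommGroup S] [Module (NakayamaAlgebra k n t) S]
    [IsSimpleModule (NakayamaAlgebra k n t) S]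
    (l₁ : ℕ) (hl₁ : l₁ = Nat.card (AddSubgroup.zmultiples (r : ZMod n))) :
    -- `l₂` does not exist
    ((¬ ∃ l : ℕ, l * r + 1 ≡ 0 [MOD n]) →
      ∃ e : Polynomial k ≃ₐ[k] ExtAlgebra (NakayamaAlgebra k n t) S,
        (e Polynomial.X).HasDegree (2 * l₁)) ∧
    -- `l₂` exists and `t ≥ 3`
    (∀ l₂ : ℕ, IsLeast {l : ℕ | l * r + 1 ≡ 0 [MOD n]} l₂ → 3 ≤ t →
      ∃ e : (MvPolynomial (Fin 2) k ⧸ Ideal.span {(MvPolynomial.X 1 : MvPolynomial (Fin 2) k) ^ 2})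
          ≃ₐ[k] ExtAlgebra (NakayamaAlgebra k n t) S,
        (e (Ideal.Quotient.mk _ (MvPolynomial.X 0))).HasDegree (2 * l₁) ∧
        (e (Ideal.Quotient.mk _ (MvPolynomial.X 1))).HasDegree (2 * l₂ + 1)) ∧
    -- `l₂` exists and `t = 2`
    (∀ l₂ : ℕ, IsLeast {l : ℕ | l * r + 1 ≡ 0 [MOD n]} l₂ → t = 2 →
      ∃ e : Polynomial k ≃ₐ[k] ExtAlgebra (NakayamaAlgebra k n t) S,
        (e Polynomial.X).HasDegree (2 * l₂ + 1)) := by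
  obtain ⟨m, rfl⟩ : ∃ m, n = m + 1 := ⟨n - 1, by omega⟩
  obtain ⟨s, rfl⟩ : ∃ s, t = s + 2 := ⟨t - 2, by omega⟩
  have h : CyclicPresentation k (Λ := NakayamaAlgebra k (m + 1) (s + 2)) (V := ATilde m) s _ _ :=
    NakayamaAlgebra.cyclicPresentation k m s
  -- Modulo `n = m + 1` the length `t` may be replaced by its remainder `r`.
  have hmul : ∀ l, l * (s + 2) = (m + 1) * (l * q) + l * r := fun l => by rw [htqr]; ring
  have h₁ : ∀ l : ℕ, ((l * (s + 2) : ℕ) : ATilde m) = 0 ↔ l₁ ∣ l := fun l => by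
    rw [ATilde.natCast_eq_zero_iff, hmul, Nat.dvd_add_right (dvd_mul_right _ _), hl₁,
      Nat.card_zmultiples, addOrderOf_dvd_iff_nsmul_eq_zero, nsmul_eq_mul, ← Nat.cast_mul,
      ZMod.natCast_eq_zero_iff]
  have h₂ : ∀ l : ℕ, ((l * (s + 2) + 1 : ℕ) : ATilde m) = 0 ↔ l * r + 1 ≡ 0 [MOD m + 1] := fun l => by
    rw [ATilde.natCast_eq_zero_iff, hmul, add_assoc, Nat.dvd_add_right (dvd_mul_right _ _),
      Nat.modEq_zero_iff_dvd]
  have hpos : 0 < l₁ := by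
    rw [hl₁]
    exact Nat.card_pos
  refine ⟨fun hne => ?_, fun l₂ hl₂ ht => ?_, fun l₂ hl₂ ht => ?_⟩
  · exact h.exists_algEquiv_of_forall_ne S hpos h₁ fun l hl => hne ⟨l, (h₂ l).1 hl⟩
  · simp only [← h₂] at hl₂
    exact h.exists_algEquiv_of_ne S (by omega) hpos h₁ hl₂
  · have hs : s = 0 := by omega
    refine h.exists_algEquiv_of_eq S hs fun d => ?_
    simp only [← h₂, ATilde.natCast_eq_zero_iff, hs] at hl₂
    obtain ⟨c, hc⟩ : m + 1 ∣ 2 * l₂ + 1 := by simpa [mul_comm] using hl₂.1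
    -- For `t = 2` the number `n = m + 1` divides the odd number `2 * l₂ + 1`, so `n` is odd and `m
    -- / 2` solves the congruence exactly. Minimality gives `2 * l₂ + 1 ≤ n`, hence equality: the
    -- degree of `y` is `n`.
    have hm : ¬ 2 ∣ m + 1 := fun ⟨b, hb⟩ => by
      rw [hb, mul_assoc] at hc
      omega
    have hle : l₂ ≤ m / 2 := hl₂.2 ⟨1, by omega⟩
    have h2 : 2 * l₂ + 1 = m + 1 := by
      refine le_antisymm (by omega) (Nat.le_of_dvd (Nat.succ_pos _) ⟨c, hc⟩)
    rw [ATilde.natCast_eq_zero_iff, h2]
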